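/- Let $\mathbb S$ be the complex sextonion algebra, i.e. the $6$-dimensional algebra with underlying vector space $\mathrm{End}(\mathbb C^2)\oplus\mathbb C^2$ and multiplication $$(X,\mu)*(X',\mu')=\bigl(XX',\ (\operatorname{trace}(X)\,\mathrm{Id}-X)\mu'+X'\mu\bigr),$$ and let $T_{\mathbb S}\in \mathbb S^*\otimes\mathbb S^*\otimes\mathbb S$ be its structure tensor. Up to permuting the three tensor factors and changing bases, $T_{\mathbb S}$ is the tensor $T\in\mathbb C^6\otimes\mathbb C^6\otimes\mathbb C^6$ whose associated space of matrices $T((\mathbb C^6)^*)$ is "Case (III)", $$ \begin{pmatrix} a_1&0&0&0&-a_3&-a_5\\ 0&a_1&0&0&-a_4&-a_6\\ 0&0&a_1&0&a_2&0\\ 0&0&0&a_1&0&a_2\\ a_2&0&a_3&a_5&0&0\\ 0&a_2&a_4&a_6&0&0 \end{pmatrix},\qquad a_1,\dots,a_6\in\mathbb C. $$ The border rank of a tensor is the smallest $r$ such that the tensor is a limit of tensors of rank at most $r$. Then the border rank of $T_{\mathbb S}$ is exactly $10$; that is, both the structure tensor of $\mathbb S$ (in any basis of $\mathbb S$) and the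 tensor of Case (III) have border rank $10$. -/

import Mathlib

/-- The rank of the three-way tensor with coordinates `T i j k`: the smallest `r` such that `T` is a
sum of `r` tensors of the form `a ⊗ b ⊗ c`. -/
noncomputable def tensorRank {ι κ μ : Type*} [Finite ι] [Finite κ] [Finite μ]
    (T : ι → κ → μ → ℂ) : ℕ :=
  sInf {r : ℕ | ∃ (a : Fin r → ι → ℂ) (b : Fin r → κ → ℂ) (c : Fin r → μ → ℂ),
    ∀ i j k, T i j k = ∑ s, a s i * b s j * c s k}

/-- The border rank: the smallest `r` such that `T` is a limit of tensors of rank at most `r`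
(the closure is for the usual topology of `ℂ^(ι × κ × μ)`). -/
noncomputable def borderRank {ι κ μ : Type*} [Finite ι] [Finite κ] [Finite μ]
    (T : ι → κ → μ → ℂ) : ℕ :=
  sInf {r : ℕ | T ∈ closure {T' : ι → κ → μ → ℂ | tensorRank T' ≤ r}}

/-- The structure tensor, in a basis `b`, of a (not necessarily associative) algebra with
multiplication `mul`: `T i j k` is the coefficient of `b k` in the product of `b i` and `b j`. -/
noncomputable def structureTensor {ι S : Type*} [AddCommGroup S] [Module ℂ S]
    (mul : S →ₗ[ℂ] S →ₗ[ℂ] S) (b : Module.Basis ι ℂ S) : ι → ι → ι → ℂ :=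
  fun i j k => b.repr (mul (b i) (b j)) k

/-- The underlying vector space `End(ℂ²) ⊕ ℂ²` of the complex sextonions. -/
abbrev Sextonion : Type := Matrix (Fin 2) (Fin 2) ℂ × (Fin 2 → ℂ)

open scoped Matrix in
/-- The multiplication of the sextonions,
`(X, μ) * (X', μ') = (X X', (trace(X) Id - X) μ' + X' μ)`. -/
noncomputable def sextonionMul : Sextonion →ₗ[ℂ] Sextonion →ₗ[ℂ] Sextonion :=
  LinearMap.mk₂ ℂ
    (fun x y => (x.1 * y.1,
      (x.1.trace • (1 : Matrix (Fin 2) (Fin 2) ℂ) - x.1) *ᵥ y.2 + y.1 *ᵥ x.2))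
    (by
      intro x x' y
      refine Prod.ext ?_ ?_
      · simp [Matrix.add_mul]
      · simp only [Prod.fst_add, Prod.snd_add, Matrix.trace_add, Matrix.sub_mulVec,
          Matrix.add_mulVec, Matrix.smul_mulVec, Matrix.one_mulVec, Matrix.mulVec_add]
        module)
    (by
      intro c x y
      refine Prod.ext ?_ ?_
      · simp
      · simp only [Prod.smul_fst, Prod.smul_snd, Matrix.trace_smul, Matrix.sub_mulVec,
          Matrix.smul_mulVec, Matrix.one_mulVec, Matrix.mulVec_smul, smul_eq_mul]
        module)
    (by
      intro x y y'
      refine Prod.ext ?_ ?_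
      · simp [Matrix.mul_add]
      · simp only [Prod.fst_add, Prod.snd_add, Matrix.add_mulVec, Matrix.mulVec_add]
        module)
    (by
      intro c x y
      refine Prod.ext ?_ ?_
      · simp
      · simp only [Prod.smul_fst, Prod.smul_snd, Matrix.smul_mulVec, Matrix.mulVec_smul]
        module)

/-- The generic element of the six-dimensional space of `6 × 6` matrices of bounded rank four
called Case (III); the coordinates `a₁, …, a₆` are `a 0, …, a 5`. -/
def caseIIIMatrix (a : Fin 6 → ℂ) : Matrix (Fin 6) (Fin 6) ℂ :=
  !![a 0, 0, 0, 0, -a 2, -a 4;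
     0, a 0, 0, 0, -a 3, -a 5;
     0, 0, a 0, 0, a 1, 0;
     0, 0, 0, a 0, 0, a 1;
     a 1, 0, a 2, a 4, 0, 0;
     0, a 1, a 3, a 5, 0, 0]

/-- The tensor `T` in `A ⊗ B ⊗ C` whose space of matrices `T(A^*) ⊆ B ⊗ C` is Case (III): the `i`-th
slice of `T` is the matrix of Case (III) with `aᵢ = 1` and the other coordinates `0`. -/
def caseIIITensor : Fin 6 → Fin 6 → Fin 6 → ℂ :=
  fun i j k => caseIIIMatrix (Pi.single i 1) j k

/-!
All bases of the sextonions give the same border rank, and Case (III) is the structure tensor up to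
a cyclic permutation of the factors and signed permutations of the bases
(`borderRank_structureTensor_sextonionMul`, `borderRank_sextonionTensor_eq_caseIIITensor`). So it
suffices to treat one tensor `T ∈ A ⊗ B ⊗ C`, namely `sextonionTensor`.

*Upper bound* (`borderRank_sextonionTensor_le`). Ten rank one tensors with integral coordinates have
a sum whose leading part, for suitable integral weights of the coordinates, is `T`. Rescaling the
coordinates by powers of a parameter makes this sum converge to `T`.

*Lower bound* (`IsBorelFixed.false`). This is border apolarity in multidegree `(1, 1, 0)`, tested in
degrees `(2, 1, 0)` and `(1, 2, 0)`. If `T` is a limit of tensors `∑ s, a s ⊗ b s ⊗ c s` with nine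
terms, then the spans of the `a s ⊗ b s`, enlarged to dimension nine by further tensors of rank one
if necessary, have a limit `F ⊆ A ⊗ B`. It contains the slices of `T`. The image of `F ⊗ A` in
`Λ²A ⊗ B` has dimension at most `9 * 5 = 45`, since a tensor `a ⊗ b` contributes only
`(A / ℂ a) ∧ a ⊗ b`, and likewise for the image of `F ⊗ B` in `A ⊗ Λ²B` (`exists_isApolar`). These
conditions are closed and invariant under the symmetries of `T`. As in Borel's fixed point theorem,
`F` may be chosen stable under a torus and under four unipotent symmetries
(`exists_isApolar_stable`).

A stable `F` is spanned by the six slices of `T` and by three further weight vectors. The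
infinitesimal symmetries relate the possible weight vectors: if `F` contains one that is no slice,
then it also contains one of a few elementary matrices. For four triples of elementary matrices, one
of the two images of the span of the slices and the triple contains `46` linearly independent
elements, which are exhibited in triangular form (`length_le_finrank_wedgeSpan`). So `F` contains
none of these triples, and this leaves at most eight dimensions, whereas `F` has dimension nine.
-/

open Filter Topology

/-! ### Rank and border rank -/

/-- The tensor `T` is a sum of `r` tensors of the form `a ⊗ b ⊗ c` (some of which may vanish). -/
def IsSumOfRankOne {ι κ μ : Type*} (r : ℕ) (T : ι → κ → μ → ℂ) : Prop :=
  ∃ (a : Fin r → ι → ℂ) (b : Fin r → κ → ℂ) (c : Fin r → μ → ℂ),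
    ∀ i j k, T i j k = ∑ s, a s i * b s j * c s k

section Rank

variable {ι κ μ : Type*} {r s : ℕ}

theorem IsSumOfRankOne.mono {T : ι → κ → μ → ℂ} (h : IsSumOfRankOne r T) (hrs : r ≤ s) :
    IsSumOfRankOne s T := by
  induction s, hrs using Nat.le_induction with
  | base => exact h
  | succ n _ ih =>
    obtain ⟨a, b, c, hT⟩ := ih
    refine ⟨Fin.snoc (α := fun _ => ι → ℂ) a 0, Fin.snoc (α := fun _ => κ → ℂ) b 0,
      Fin.snoc (α := fun _ => μ → ℂ) c 0, fun i j k => ?_⟩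
    simp [Fin.sum_univ_castSucc, hT]

theorem exists_isSumOfRankOne [Finite ι] [Finite κ] [Finite μ] (T : ι → κ → μ → ℂ) :
    ∃ r, IsSumOfRankOne r T := by
  classical
  cases nonempty_fintype ι
  cases nonempty_fintype κ
  cases nonempty_fintype μ
  let e := Fintype.equivFin (ι × κ × μ)
  refine ⟨Fintype.card (ι × κ × μ), fun s => Pi.single (e.symm s).1 (T (e.symm s).1
      (e.symm s).2.1 (e.symm s).2.2), fun s => Pi.single (e.symm s).2.1 1,
    fun s => Pi.single (e.symm s).2.2 1, fun i j k => ?_⟩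
  rw [Equiv.sum_comp e.symm (fun p : ι × κ × μ => (Pi.single p.1 (T p.1 p.2.1 p.2.2) : ι → ℂ) i *
    (Pi.single p.2.1 1 : κ → ℂ) j * (Pi.single p.2.2 1 : μ → ℂ) k)]
  rw [Finset.sum_eq_single (i, j, k)]
  · simp
  · rintro ⟨i', j', k'⟩ - hne
    by_cases h1 : i = i'
    · by_cases h2 : j = j'
      · have h3 : k ≠ k' := by rintro rfl; exact hne (by rw [h1, h2])
        simp [Pi.single_apply, h3]
      · simp [Pi.single_apply, h2]
    · simp [Pi.single_apply, h1]
  · simp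

theorem tensorRank_le_iff [Finite ι] [Finite κ] [Finite μ] {T : ι → κ → μ → ℂ} :
    tensorRank T ≤ r ↔ IsSumOfRankOne r T := by
  constructor
  · intro h
    have : IsSumOfRankOne (tensorRank T) T := Nat.sInf_mem (exists_isSumOfRankOne T)
    exact this.mono h
  · intro h
    exact Nat.sInf_le h

theorem borderRank_le_iff [Finite ι] [Finite κ] [Finite μ] {T : ι → κ → μ → ℂ} :
    borderRank T ≤ r ↔ T ∈ closure {T' : ι → κ → μ → ℂ | IsSumOfRankOne r T'} := by
  simp only [borderRank, tensorRank_le_iff]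
  constructor
  · intro h
    have hne : {r : ℕ | T ∈ closure {T' : ι → κ → μ → ℂ | IsSumOfRankOne r T'}}.Nonempty := by
      obtain ⟨r, hr⟩ := exists_isSumOfRankOne T
      exact ⟨r, subset_closure hr⟩
    exact closure_mono (fun T' (h' : IsSumOfRankOne _ T') => h'.mono h) (Nat.sInf_mem hne)
  · intro h
    exact Nat.sInf_le h

theorem borderRank_le_of_continuous {ι' κ' μ' : Type*} [Finite ι] [Finite κ] [Finite μ]
    [Finite ι'] [Finite κ'] [Finite μ'] (Φ : (ι → κ → μ → ℂ) → (ι' → κ' → μ' → ℂ))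
    (hc : Continuous Φ) (hΦ : ∀ r T, IsSumOfRankOne r T → IsSumOfRankOne r (Φ T))
    (T : ι → κ → μ → ℂ) : borderRank (Φ T) ≤ borderRank T := by
  rw [borderRank_le_iff]
  exact map_mem_closure hc (borderRank_le_iff.1 le_rfl) fun T' hT' => hΦ _ _ hT'

end Rank

/-! ### Structure tensors in different bases -/

section StructureTensor

variable {S ι ι' : Type*} [AddCommGroup S] [Module ℂ S] [Fintype ι] [Fintype ι']

/-- The border rank of a structure tensor does not depend on the basis. -/
theorem borderRank_structureTensor_le (mul : S →ₗ[ℂ] S →ₗ[ℂ] S) (b : Module.Basis ι ℂ S)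
    (b' : Module.Basis ι' ℂ S) :
    borderRank (structureTensor mul b) ≤ borderRank (structureTensor mul b') := by
  let P : ι → ι' → ℂ := fun i i' => b'.repr (b i) i'
  let R : ι → ι' → ℂ := fun k k' => b.repr (b' k') k
  let Φ : (ι' → ι' → ι' → ℂ) → (ι → ι → ι → ℂ) := fun T i j k =>
    ∑ k', ∑ i', ∑ j', P i i' * P j j' * R k k' * T i' j' k'
  have hΦT : structureTensor mul b = Φ (structureTensor mul b') := by
    funext i j k
    have hr : ∀ x, b.repr x k = ∑ k', R k k' * b'.repr x k' := by
      intro x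
      conv_lhs => rw [← b'.sum_repr x]
      simp only [map_sum, map_smul, Finsupp.coe_finsetSum, Finset.sum_apply, Finsupp.smul_apply,
        smul_eq_mul, R]
      exact Finset.sum_congr rfl fun _ _ => mul_comm _ _
    have hm : mul (b i) (b j) = ∑ i', ∑ j', (P i i' * P j j') • mul (b' i') (b' j') := by
      conv_lhs => rw [← b'.sum_repr (b i), ← b'.sum_repr (b j)]
      simp only [map_sum, map_smul, LinearMap.sum_apply, LinearMap.smul_apply, Finset.smul_sum,
        smul_smul, P]
      rw [Finset.sum_comm]
      simp only [mul_comm]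
    simp only [structureTensor, Φ]
    rw [hr, hm]
    refine Finset.sum_congr rfl fun k' _ => ?_
    simp only [map_sum, map_smul, Finsupp.coe_finsetSum, Finset.sum_apply, Finsupp.smul_apply,
      smul_eq_mul, Finset.mul_sum]
    exact Finset.sum_congr rfl fun i' _ => Finset.sum_congr rfl fun j' _ => by ring
  rw [hΦT]
  refine borderRank_le_of_continuous Φ (by fun_prop) ?_ _
  rintro r T ⟨a, β, c, hT⟩
  refine ⟨fun s i => ∑ i', P i i' * a s i', fun s j => ∑ j', P j j' * β s j',
    fun s k => ∑ k', R k k' * c s k', fun i j k => ?_⟩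
  have h : ∀ s, (∑ i', P i i' * a s i') * (∑ j', P j j' * β s j') * (∑ k', R k k' * c s k') =
      ∑ k', ∑ i', ∑ j', P i i' * P j j' * R k k' * (a s i' * β s j' * c s k') := by
    intro s
    rw [mul_comm, Finset.sum_mul_sum, Finset.sum_mul]
    refine Finset.sum_congr rfl fun k' _ => ?_
    rw [Finset.mul_sum]
    refine Finset.sum_congr rfl fun i' _ => ?_
    rw [Finset.mul_sum]
    exact Finset.sum_congr rfl fun j' _ => by ring
  simp only [h]
  simp only [Φ, hT, Finset.mul_sum]
  rw [Finset.sum_comm (s := (Finset.univ : Finset (Fin r)))]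
  refine Finset.sum_congr rfl fun k' _ => ?_
  rw [Finset.sum_comm (s := (Finset.univ : Finset (Fin r)))]
  refine Finset.sum_congr rfl fun i' _ => ?_
  rw [Finset.sum_comm (s := (Finset.univ : Finset (Fin r)))]

end StructureTensor

/-! ### The structure tensor of the sextonions -/

/-- The coordinates on the sextonions: the four entries of the matrix, row by row, and the two
entries of the vector. -/
noncomputable def sextonionCoord : Sextonion ≃ₗ[ℂ] (Fin 6 → ℂ) where
  toFun x := ![x.1 0 0, x.1 0 1, x.1 1 0, x.1 1 1, x.2 0, x.2 1]
  invFun v := (!![v 0, v 1; v 2, v 3], ![v 4, v 5])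
  map_add' x y := by
    ext i
    fin_cases i <;> rfl
  map_smul' c x := by
    ext i
    fin_cases i <;> rfl
  left_inv x := by
    refine Prod.ext ?_ ?_
    · ext i j
      fin_cases i <;> fin_cases j <;> rfl
    · ext i
      fin_cases i <;> rfl
  right_inv v := by
    ext i
    fin_cases i <;> rfl

/-- The bilinear form on the sextonions obtained by composing the multiplication with the linear
form `∑ zₖ xₖ`, written as a matrix in the coordinates `sextonionCoord`. -/
def sextonionMatrix {R : Type*} [Ring R] (z : Fin 6 → R) : Matrix (Fin 6) (Fin 6) R :=
  !![z 0, z 1, 0, 0, 0, z 5;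
     0, 0, z 0, z 1, 0, -z 4;
     z 2, z 3, 0, 0, -z 5, 0;
     0, 0, z 2, z 3, z 4, 0;
     z 4, 0, z 5, 0, 0, 0;
     0, z 4, 0, z 5, 0, 0]

/-- The slice `i j ↦ T i j k` of the structure tensor `T` of the sextonions. -/
def sextonionSlice (R : Type*) [Ring R] (k : Fin 6) : Matrix (Fin 6) (Fin 6) R :=
  sextonionMatrix (Pi.single k 1)

/-- The structure tensor of the sextonions in the coordinates `sextonionCoord`. -/
def sextonionTensor : Fin 6 → Fin 6 → Fin 6 → ℂ := fun i j k => sextonionSlice ℂ k i j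

theorem sextonionSlice_cast (k i j : Fin 6) :
    sextonionSlice ℂ k i j = ((sextonionSlice ℤ k i j : ℤ) : ℂ) := by
  have h : ∀ l, (Pi.single k 1 : Fin 6 → ℂ) l = ((Pi.single k 1 : Fin 6 → ℤ) l : ℂ) := by
    intro l
    by_cases h : l = k <;> simp [h]
  fin_cases i <;> fin_cases j <;> simp [sextonionSlice, sextonionMatrix, h]

theorem sextonionCoord_mul (u v : Fin 6 → ℂ) (k : Fin 6) :
    sextonionCoord (sextonionMul (sextonionCoord.symm u) (sextonionCoord.symm v)) k =
      ∑ i, ∑ j, u i * v j * sextonionTensor i j k := by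
  have h : sextonionCoord (sextonionMul (sextonionCoord.symm u) (sextonionCoord.symm v)) =
      ![u 0 * v 0 + u 1 * v 2, u 0 * v 1 + u 1 * v 3, u 2 * v 0 + u 3 * v 2,
        u 2 * v 1 + u 3 * v 3, u 3 * v 4 - u 1 * v 5 + (v 0 * u 4 + v 1 * u 5),
        -(u 2 * v 4) + u 0 * v 5 + (v 2 * u 4 + v 3 * u 5)] := by
    have h1 : ∀ u, sextonionCoord.symm u = (!![u 0, u 1; u 2, u 3], ![u 4, u 5]) := fun u => rfl
    have h2 : ∀ x, sextonionCoord x = ![x.1 0 0, x.1 0 1, x.1 1 0, x.1 1 1, x.2 0, x.2 1] :=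
      fun x => rfl
    rw [h1, h1, h2]
    simp only [sextonionMul, LinearMap.mk₂_apply]
    simp [Matrix.mul_apply, Matrix.trace, Fin.sum_univ_two, sub_eq_add_neg, mul_comm]
  rw [h]
  fin_cases k <;>
    simp [Fin.sum_univ_six, sextonionTensor, sextonionSlice, sextonionMatrix] <;>
    ring

theorem structureTensor_sextonionCoord :
    structureTensor sextonionMul (Module.Basis.ofEquivFun sextonionCoord) = sextonionTensor := by
  funext i j k
  simp only [structureTensor, Module.Basis.coe_ofEquivFun, Module.Basis.ofEquivFun_repr_apply]
  rw [sextonionCoord_mul]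
  simp [Pi.single_apply]

/-! ### Case (III) -/

/-- Border rank does not grow under a cyclic permutation of the factors combined with a substitution
and rescaling of the coordinates. -/
theorem borderRank_rotate_le {ι κ μ : Type*} [Finite ι] [Finite κ] [Finite μ] {ι' κ' μ' : Type*}
    [Finite ι'] [Finite κ'] [Finite μ'] (x : ι' → ℂ) (y : κ' → ℂ) (f : κ' → ι) (g : μ' → κ)
    (h : ι' → μ) (T : ι → κ → μ → ℂ) :
    borderRank (fun p q r => x p * y q * T (f q) (g r) (h p)) ≤ borderRank T := by
  refine borderRank_le_of_continuous (fun T p q r => x p * y q * T (f q) (g r) (h p))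
    (by fun_prop) ?_ T
  rintro r T ⟨a, b, c, hT⟩
  refine ⟨fun s p => x p * c s (h p), fun s q => y q * a s (f q), fun s r => b s (g r),
    fun p q r => ?_⟩
  simp only [hT, Finset.mul_sum]
  exact Finset.sum_congr rfl fun s _ => by ring

theorem caseIIIMatrix_eq (a : Fin 6 → ℂ) (i j : Fin 6) :
    caseIIIMatrix a i j = (![-1, 1, 1, 1, 1, -1] : Fin 6 → ℂ) i *
      sextonionMatrix ![a 2, a 4, -a 3, -a 5, a 0, a 1]
        ((![1, 3, 4, 5, 0, 2] : Fin 6 → Fin 6) i) ((![5, 4, 0, 1, 2, 3] : Fin 6 → Fin 6) j) := by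
  fin_cases i <;> fin_cases j <;> simp [caseIIIMatrix, sextonionMatrix]

/-- Case (III) is the structure tensor of the sextonions up to a cyclic permutation of the factors
and signed permutations of the three bases. -/
theorem caseIIITensor_eq :
    caseIIITensor = fun p q r => (![1, 1, 1, -1, 1, -1] : Fin 6 → ℂ) p *
      (![-1, 1, 1, 1, 1, -1] : Fin 6 → ℂ) q *
        sextonionTensor ((![1, 3, 4, 5, 0, 2] : Fin 6 → Fin 6) q)
          ((![5, 4, 0, 1, 2, 3] : Fin 6 → Fin 6) r) ((![4, 5, 0, 2, 1, 3] : Fin 6 → Fin 6) p) := by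
  funext p q r
  have h : ∀ (c : ℂ) (z : Fin 6 → ℂ) i j,
      c * sextonionMatrix z i j = sextonionMatrix (c • z) i j := by
    intro c z i j
    fin_cases i <;> fin_cases j <;> simp [sextonionMatrix]
  rw [caseIIITensor, caseIIIMatrix_eq, mul_comm (Matrix.vecCons 1 _ p), mul_assoc]
  congr 1
  rw [sextonionTensor, sextonionSlice, h]
  congr 1
  funext l
  fin_cases p <;> fin_cases l <;> simp

theorem sextonionTensor_eq_caseIIITensor :
    sextonionTensor = fun i j k => (![1, 1, -1, -1, 1, 1] : Fin 6 → ℂ) k *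
      (![1, -1, -1, 1, 1, 1] : Fin 6 → ℂ) i *
        caseIIITensor ((![2, 4, 3, 5, 0, 1] : Fin 6 → Fin 6) k)
          ((![4, 0, 5, 1, 2, 3] : Fin 6 → Fin 6) i) ((![2, 3, 4, 5, 1, 0] : Fin 6 → Fin 6) j) := by
  funext i j k
  -- The permutations invert those in `caseIIITensor_eq`.
  have h1 : (![1, 3, 4, 5, 0, 2] : Fin 6 → Fin 6) ((![4, 0, 5, 1, 2, 3] : Fin 6 → Fin 6) i) = i := by
    revert i; decide
  have h2 : (![5, 4, 0, 1, 2, 3] : Fin 6 → Fin 6) ((![2, 3, 4, 5, 1, 0] : Fin 6 → Fin 6) j) = j := by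
    revert j; decide
  have h3 : (![4, 5, 0, 2, 1, 3] : Fin 6 → Fin 6) ((![2, 4, 3, 5, 0, 1] : Fin 6 → Fin 6) k) = k := by
    revert k; decide
  simp only [caseIIITensor_eq, h1, h2, h3]
  fin_cases k <;> fin_cases i <;> simp

theorem borderRank_sextonionTensor_eq_caseIIITensor :
    borderRank caseIIITensor = borderRank sextonionTensor := by
  apply le_antisymm
  · rw [caseIIITensor_eq]
    exact borderRank_rotate_le _ _ _ _ _ _
  · rw [sextonionTensor_eq_caseIIITensor]
    refine borderRank_le_of_continuous (fun T i j k => (![1, 1, -1, -1, 1, 1] : Fin 6 → ℂ) k *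
      (![1, -1, -1, 1, 1, 1] : Fin 6 → ℂ) i * T ((![2, 4, 3, 5, 0, 1] : Fin 6 → Fin 6) k)
          ((![4, 0, 5, 1, 2, 3] : Fin 6 → Fin 6) i) ((![2, 3, 4, 5, 1, 0] : Fin 6 → Fin 6) j))
      (by fun_prop) ?_ caseIIITensor
    rintro r T ⟨a, b, c, hT⟩
    refine ⟨fun s i => (![1, -1, -1, 1, 1, 1] : Fin 6 → ℂ) i *
        b s ((![4, 0, 5, 1, 2, 3] : Fin 6 → Fin 6) i),
      fun s j => c s ((![2, 3, 4, 5, 1, 0] : Fin 6 → Fin 6) j),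
      fun s k => (![1, 1, -1, -1, 1, 1] : Fin 6 → ℂ) k *
        a s ((![2, 4, 3, 5, 0, 1] : Fin 6 → Fin 6) k), fun i j k => ?_⟩
    simp only [hT, Finset.mul_sum]
    exact Finset.sum_congr rfl fun s _ => by ring

theorem borderRank_structureTensor_sextonionMul (b : Module.Basis (Fin 6) ℂ Sextonion) :
    borderRank (structureTensor sextonionMul b) = borderRank sextonionTensor := by
  rw [← structureTensor_sextonionCoord]
  exact le_antisymm (borderRank_structureTensor_le _ _ _) (borderRank_structureTensor_le _ _ _)

/-! ### The upper bound -/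

/-- If a sum of rank one tensors with integral coordinates has leading part `T` with respect to a
weight on the coordinates, then `T` is a limit of tensors of the same rank. -/
theorem mem_closure_of_leading_part {ι κ μ : Type*} {r : ℕ} (T : ι → κ → μ → ℂ)
    (a : Fin r → ι → ℤ) (b : Fin r → κ → ℤ) (c : Fin r → μ → ℤ)
    (u : ι → ℤ) (v : κ → ℤ) (w : μ → ℤ)
    (hle : ∀ i j k, u i + v j + w k ≤ 0 → T i j k = ((∑ s, a s i * b s j * c s k : ℤ) : ℂ))
    (hne : ∀ i j k, u i + v j + w k ≠ 0 → T i j k = 0) :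
    T ∈ closure {T' : ι → κ → μ → ℂ | IsSumOfRankOne r T'} := by
  let t : ℕ → ℂ := fun n => 1 / ((n : ℂ) + 1)
  have ht : Tendsto t atTop (𝓝 0) := tendsto_one_div_add_atTop_nhds_zero_nat
  have ht0 : ∀ n, t n ≠ 0 := fun n => one_div_ne_zero (by exact_mod_cast Nat.succ_ne_zero n)
  let F : ℕ → ι → κ → μ → ℂ := fun n i j k =>
    t n ^ (u i + v j + w k) * ((∑ s, a s i * b s j * c s k : ℤ) : ℂ)
  refine mem_closure_of_tendsto (f := F) (b := atTop) ?_ (Eventually.of_forall fun n => ?_)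
  · refine tendsto_pi_nhds.2 fun i => tendsto_pi_nhds.2 fun j => tendsto_pi_nhds.2 fun k => ?_
    rcases lt_trichotomy (u i + v j + w k) 0 with h | h | h
    · have h1 := hle i j k h.le
      have h2 := hne i j k h.ne
      simp only [F, ← h1, h2, mul_zero]
      exact tendsto_const_nhds
    · simp only [F, h, zpow_zero, one_mul, ← hle i j k h.le]
      exact tendsto_const_nhds
    · rw [hne i j k h.ne']
      obtain ⟨m, hm⟩ := Int.eq_ofNat_of_zero_le h.le
      have hm0 : m ≠ 0 := by rintro rfl; simp [hm] at h
      simp only [F, hm, zpow_natCast]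
      simpa [hm0] using (ht.pow m).mul_const ((∑ s, a s i * b s j * c s k : ℤ) : ℂ)
  · refine ⟨fun s i => t n ^ u i * a s i, fun s j => t n ^ v j * b s j,
      fun s k => t n ^ w k * c s k, fun i j k => ?_⟩
    simp only [F, zpow_add₀ (ht0 n)]
    push_cast
    rw [Finset.mul_sum]
    exact Finset.sum_congr rfl fun s _ => by ring

/-- In the nonpositive total weights, the sum of the ten rank one tensors agrees with the tensor, which
has no coordinates of nonzero total weight. -/
theorem borderRank_sextonionTensor_le : borderRank sextonionTensor ≤ 10 := by
  rw [borderRank_le_iff]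
  refine mem_closure_of_leading_part sextonionTensor
    ![![0, 1, -1, -1, 0, 0], ![0, 0, 0, 1, -1, 0], ![1, 0, 0, 1, 0, 0], ![1, -1, 0, 0, 0, 0],
      ![0, 1, 0, 0, 0, -1], ![0, 0, 1, 1, -1, 0], ![0, 1, 0, 1, 0, -1], ![0, 1, 0, 0, 0, 1],
      ![0, 0, 1, 1, 0, 0], ![1, 0, 0, 0, 2, 0]]
    ![![0, 1, 0, 0, 0, 1], ![1, 0, -1, 0, 1, 0], ![1, 1, 0, -1, 0, 0], ![0, 1, 0, -1, 0, 1],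
      ![0, 1, 1, 0, 0, 0], ![1, 0, 0, 0, 0, 1], ![0, 1, 1, -1, 0, 0], ![0, 1, 0, 0, 0, 0],
      ![1, -1, 0, 0, 1, 0], ![1, 0, 0, 0, 0, 0]]
    ![![0, 0, 0, -1, -1, 1], ![0, 0, -1, 0, 0, 1], ![0, 0, 0, 0, 0, -1], ![0, 1, 0, 0, 0, 1],
      ![1, 1, 0, 0, 0, -1], ![0, 0, 1, 0, -1, 1], ![0, 0, 0, -1, 0, 1], ![-1, 0, 0, 0, 1, 0],
      ![0, 0, 0, 0, 1, -1], ![1, 0, 0, 0, 0, 1]]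
    ![12, 6, -6, -12, 26, 28] ![-2, -4, 4, 2, 36, 18] ![-10, -8, 8, 10, -24, -30] ?_ ?_
  · intro i j k h
    rw [sextonionTensor, sextonionSlice_cast, Int.cast_inj]
    revert i j k
    decide
  · intro i j k h
    rw [sextonionTensor, sextonionSlice_cast, Int.cast_eq_zero]
    revert i j k
    decide

/-! ### Limits of subspaces -/

section Limits

variable {V : Type*} [AddCommGroup V] [Module ℂ V] [TopologicalSpace V]

/-- `G` is the limit of the sequence of subspaces `F`, in the sense of Kuratowski: it is the set of
limits of sequences of vectors of the `F n`, and every such limit lies in it. -/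
def IsSubspaceLimit (F : ℕ → Submodule ℂ V) (G : Submodule ℂ V) : Prop :=
  (∀ g ∈ G, ∃ f : ℕ → V, (∀ n, f n ∈ F n) ∧ Tendsto f atTop (𝓝 g)) ∧
    ∀ (f : ℕ → V) (g : V), (∀ n, f n ∈ F n) → Tendsto f atTop (𝓝 g) → g ∈ G

theorem exists_subspaceLimit_euclidean {N d : ℕ}
    (F : ℕ → Submodule ℂ (EuclideanSpace ℂ (Fin N))) (hF : ∀ n, Module.finrank ℂ (F n) = d) :
    ∃ φ : ℕ → ℕ, StrictMono φ ∧ ∃ G : Submodule ℂ (EuclideanSpace ℂ (Fin N)),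
      Module.finrank ℂ G = d ∧ IsSubspaceLimit (F ∘ φ) G := by
  let o : ∀ n, OrthonormalBasis (Fin d) ℂ (F n) := fun n =>
    (stdOrthonormalBasis ℂ (F n)).reindex (finCongr (hF n))
  let x : ℕ → Fin d → EuclideanSpace ℂ (Fin N) := fun n i => (o n i : EuclideanSpace ℂ (Fin N))
  have hx : ∀ n, Orthonormal ℂ (x n) := fun n =>
    (o n).orthonormal.comp_linearIsometry (F n).subtypeₗᵢ
  have hb : ∀ n, x n ∈ Metric.closedBall (0 : Fin d → EuclideanSpace ℂ (Fin N)) 1 := by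
    intro n
    rw [mem_closedBall_zero_iff, pi_norm_le_iff_of_nonneg zero_le_one]
    exact fun i => ((hx n).1 i).le
  obtain ⟨y, -, φ, hφ, hy⟩ :=
    (isCompact_closedBall (0 : Fin d → EuclideanSpace ℂ (Fin N)) 1).tendsto_subseq hb
  have hyi : ∀ i, Tendsto (fun n => x (φ n) i) atTop (𝓝 (y i)) := fun i => tendsto_pi_nhds.1 hy i
  have hyo : Orthonormal ℂ y := by
    rw [orthonormal_iff_ite]
    intro i j
    have h1 := (hyi i).inner (𝕜 := ℂ) (hyi j)
    have h2 : ∀ n, inner ℂ (x (φ n) i) (x (φ n) j) = if i = j then (1 : ℂ) else 0 :=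
      fun n => orthonormal_iff_ite.1 (hx (φ n)) i j
    simp only [h2] at h1
    exact (tendsto_nhds_unique h1 tendsto_const_nhds)
  refine ⟨φ, hφ, Submodule.span ℂ (Set.range y), ?_, ?_, ?_⟩
  · simpa using finrank_span_eq_card hyo.linearIndependent
  · intro g hg
    obtain ⟨c, rfl⟩ := (Submodule.mem_span_range_iff_exists_fun ℂ).1 hg
    refine ⟨fun n => ∑ i, c i • x (φ n) i, fun n => ?_, ?_⟩
    · exact Submodule.sum_mem _ fun i _ => Submodule.smul_mem _ _ (o (φ n) i).2
    · exact tendsto_finsetSum _ fun i _ => (hyi i).const_smul (c i)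
  · intro f g hf hg
    have h1 : ∀ n, f n = ∑ i, inner ℂ (x (φ n) i) (f n) • x (φ n) i := by
      intro n
      have := congrArg Subtype.val ((o (φ n)).sum_repr' ⟨f n, hf n⟩)
      simpa [x] using this.symm
    have h2 : Tendsto f atTop (𝓝 (∑ i, inner ℂ (y i) g • y i)) := by
      rw [show f = fun n => ∑ i, inner ℂ (x (φ n) i) (f n) • x (φ n) i from funext h1]
      exact tendsto_finsetSum _ fun i _ => ((hyi i).inner hg).smul (hyi i)
    rw [tendsto_nhds_unique hg h2]
    exact Submodule.sum_mem _ fun i _ => Submodule.smul_mem _ _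
      (Submodule.subset_span (Set.mem_range_self i))

variable [IsTopologicalAddGroup V] [ContinuousSMul ℂ V] [T2Space V] [FiniteDimensional ℂ V]

/-- Compactness of the Grassmannian: a sequence of subspaces of fixed dimension has a convergent
subsequence. -/
theorem exists_subspaceLimit {d : ℕ} (F : ℕ → Submodule ℂ V)
    (hF : ∀ n, Module.finrank ℂ (F n) = d) :
    ∃ φ : ℕ → ℕ, StrictMono φ ∧ ∃ G : Submodule ℂ V,
      Module.finrank ℂ G = d ∧ IsSubspaceLimit (F ∘ φ) G := by
  let e : V ≃L[ℂ] EuclideanSpace ℂ (Fin (Module.finrank ℂ V)) :=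
    ContinuousLinearEquiv.ofFinrankEq (by simp)
  obtain ⟨φ, hφ, G, hG, h1, h2⟩ := exists_subspaceLimit_euclidean
    (fun n => (F n).map e.toLinearEquiv.toLinearMap) (d := d)
    (fun n => (LinearEquiv.finrank_map_eq e.toLinearEquiv (F n)).trans (hF n))
  refine ⟨φ, hφ, G.map e.symm.toLinearEquiv.toLinearMap,
    (LinearEquiv.finrank_map_eq e.symm.toLinearEquiv G).trans hG, ?_, ?_⟩
  · rintro _ ⟨g, hg, rfl⟩
    obtain ⟨f, hf, hfg⟩ := h1 g hg
    refine ⟨fun n => e.symm (f n), fun n => ?_, (e.symm.continuous.tendsto g).comp hfg⟩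
    obtain ⟨v, hv, hve⟩ := hf n
    have : e v = f n := hve
    change e.symm (f n) ∈ F (φ n)
    rw [← this, e.symm_apply_apply]
    exact hv
  · intro f g hf hg
    refine ⟨e g, h2 (fun n => e (f n)) (e g) (fun n => ⟨f n, hf n, rfl⟩)
      ((e.continuous.tendsto g).comp hg), e.symm_apply_apply g⟩

/-- Lower semicontinuity of the dimension of a span. -/
theorem eventually_le_finrank {X : Type*} {l : Filter X} {r : ℕ} {x : X → Fin r → V}
    {y : Fin r → V} (hx : Tendsto x l (𝓝 y)) (hy : LinearIndependent ℂ y)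
    {W : X → Submodule ℂ V} (hW : ∀ᶠ n in l, ∀ i, x n i ∈ W n) :
    ∀ᶠ n in l, r ≤ Module.finrank ℂ (W n) := by
  let e : V ≃L[ℂ] EuclideanSpace ℂ (Fin (Module.finrank ℂ V)) :=
    ContinuousLinearEquiv.ofFinrankEq (by simp)
  have he : ∀ z : Fin r → V, LinearIndependent ℂ (e.toLinearEquiv.toLinearMap ∘ z) ↔
      LinearIndependent ℂ z := fun z =>
    e.toLinearEquiv.toLinearMap.linearIndependent_iff e.toLinearEquiv.ker
  have ho : ∀ᶠ n in l, LinearIndependent ℂ (e.toLinearEquiv.toLinearMap ∘ x n) := by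
    have h1 : Tendsto (fun n => e.toLinearEquiv.toLinearMap ∘ x n) l
        (𝓝 (e.toLinearEquiv.toLinearMap ∘ y)) :=
      tendsto_pi_nhds.2 fun i => (e.continuous.tendsto _).comp (tendsto_pi_nhds.1 hx i)
    exact h1.eventually (LinearIndependent.eventually ((he y).2 hy))
  filter_upwards [ho, hW] with n hn hWn
  have h2 : LinearIndependent ℂ fun i => (⟨x n i, hWn i⟩ : W n) :=
    LinearIndependent.of_comp (W n).subtype ((he _).1 hn)
  simpa using h2.fintype_card_le_finrank

end Limits

/-! ### Borel-fixed subspaces -/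

section Borel

theorem finrank_map_add_finrank_inf_ker {V W : Type*} [AddCommGroup V] [Module ℂ V]
    [FiniteDimensional ℂ V] [AddCommGroup W] [Module ℂ W] (f : V →ₗ[ℂ] W) (S : Submodule ℂ V) :
    Module.finrank ℂ (S.map f) + Module.finrank ℂ (S ⊓ LinearMap.ker f : Submodule ℂ V) =
      Module.finrank ℂ S := by
  rw [← LinearMap.finrank_range_add_finrank_ker (f.domRestrict S), LinearMap.range_domRestrict,
    LinearMap.ker_domRestrict, ← Submodule.map_comap_subtype, Submodule.finrank_map_subtype_eq]

variable {V : Type*} [AddCommGroup V] [Module ℂ V]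

/-- A grading of `V` by the degrees `0, …, N - 1`, given by the projections to the homogeneous
components. -/
structure IsGrading (N : ℕ) (π : ℕ → Module.End ℂ V) : Prop where
  comp_self : ∀ i v, π i (π i v) = π i v
  comp_of_ne : ∀ i j v, i ≠ j → π i (π j v) = 0
  sum_eq : ∀ v, ∑ i ∈ Finset.range N, π i v = v

/-- The projection to the sum of the homogeneous components of degree less than `m`. -/
def gradeTrunc (π : ℕ → Module.End ℂ V) (m : ℕ) : Module.End ℂ V := ∑ i ∈ Finset.range m, π i

/-- The action of `t` in the one-parameter torus defined by the grading. -/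
def gradeTorus (N : ℕ) (π : ℕ → Module.End ℂ V) (t : ℂ) : Module.End ℂ V :=
  ∑ i ∈ Finset.range N, t ^ i • π i

variable {N : ℕ} {π : ℕ → Module.End ℂ V}

theorem gradeTrunc_succ (m : ℕ) (v : V) :
    gradeTrunc π (m + 1) v = gradeTrunc π m v + π m v := by
  simp [gradeTrunc, Finset.sum_range_succ]

theorem IsGrading.proj_trunc_of_le (h : IsGrading N π) {m j : ℕ} (hmj : m ≤ j) (v : V) :
    π j (gradeTrunc π m v) = 0 := by
  simp only [gradeTrunc, LinearMap.sum_apply, map_sum]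
  exact Finset.sum_eq_zero fun i hi => h.comp_of_ne _ _ _ (by have := Finset.mem_range.1 hi; omega)

theorem IsGrading.trunc_proj_of_le (h : IsGrading N π) {m j : ℕ} (hmj : m ≤ j) (v : V) :
    gradeTrunc π m (π j v) = 0 := by
  simp only [gradeTrunc, LinearMap.sum_apply]
  exact Finset.sum_eq_zero fun i hi => h.comp_of_ne _ _ _ (by have := Finset.mem_range.1 hi; omega)

theorem IsGrading.trunc_top (h : IsGrading N π) (v : V) : gradeTrunc π N v = v := by
  simpa [gradeTrunc] using h.sum_eq v

theorem IsGrading.trunc_trunc (h : IsGrading N π) (m : ℕ) (v : V) :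
    gradeTrunc π m (gradeTrunc π m v) = gradeTrunc π m v := by
  induction m with
  | zero => simp [gradeTrunc]
  | succ m ih =>
    simp only [gradeTrunc_succ, map_add, h.proj_trunc_of_le le_rfl, h.trunc_proj_of_le le_rfl,
      h.comp_self, ih, add_zero, zero_add]

variable [FiniteDimensional ℂ V]

/-- If `F'` contains the component of lowest degree of every element of `F`, and has the same
dimension, then it is homogeneous, and it is at least as large as `F` in low degrees. -/
theorem IsGrading.homogeneous_of_lowest_mem (h : IsGrading N π) {F F' : Submodule ℂ V}
    (hd : Module.finrank ℂ F' = Module.finrank ℂ F)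
    (hF : ∀ j, ∀ f ∈ F, gradeTrunc π j f = 0 → π j f ∈ F') :
    (∀ f ∈ F', ∀ j, π j f ∈ F') ∧ ∀ m, Module.finrank ℂ (F.map (gradeTrunc π m)) ≤
      Module.finrank ℂ (F'.map (gradeTrunc π m)) := by
  -- `H` is the sum of the lowest components of the elements of `F` in degrees less than `m`.
  have key : ∀ m, ∃ H ≤ F', (∀ v ∈ H, gradeTrunc π m v = v) ∧ (∀ v ∈ H, ∀ j, π j v ∈ H) ∧
      Module.finrank ℂ F ≤ Module.finrank ℂ H +
        Module.finrank ℂ (F ⊓ LinearMap.ker (gradeTrunc π m) : Submodule ℂ V) := by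
    intro m
    induction m with
    | zero =>
      refine ⟨⊥, bot_le, by simp, by simp, ?_⟩
      have h0 : gradeTrunc π 0 = 0 := by simp [gradeTrunc]
      rw [h0, LinearMap.ker_zero, inf_top_eq]
      omega
    | succ m ih =>
      obtain ⟨H, hHF, h1, h2, h3⟩ := ih
      set K := (F ⊓ LinearMap.ker (gradeTrunc π m) : Submodule ℂ V)
      refine ⟨H ⊔ K.map (π m), sup_le hHF ?_, ?_, ?_, ?_⟩
      · rintro _ ⟨f, ⟨hf, hfk⟩, rfl⟩
        exact hF m f hf hfk
      · intro v hv
        obtain ⟨a, ha, _, ⟨f, hf, rfl⟩, rfl⟩ := Submodule.mem_sup.1 hv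
        rw [gradeTrunc_succ, map_add, map_add, h1 a ha, h.trunc_proj_of_le le_rfl, h.comp_self,
          ← h1 a ha, h.proj_trunc_of_le le_rfl]
        simp
      · intro v hv j
        obtain ⟨a, ha, _, ⟨f, hf, rfl⟩, rfl⟩ := Submodule.mem_sup.1 hv
        rw [map_add]
        refine Submodule.add_mem_sup (h2 a ha j) ?_
        by_cases hj : j = m
        · subst hj
          rw [h.comp_self]
          exact Submodule.mem_map_of_mem hf
        · rw [h.comp_of_ne _ _ _ hj]
          exact Submodule.zero_mem _
      · have hdisj : H ⊓ K.map (π m) = ⊥ := by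
          rw [eq_bot_iff]
          rintro v ⟨hv, ⟨f, hf, rfl⟩⟩
          have := h.proj_trunc_of_le (le_refl m) (π m f)
          rw [h1 _ hv, h.comp_self] at this
          exact (Submodule.mem_bot ℂ).2 this
        have h4 := Submodule.finrank_sup_add_finrank_inf_eq H (K.map (π m))
        rw [hdisj, finrank_bot] at h4
        have h5 := finrank_map_add_finrank_inf_ker (π m) K
        have h6 : Module.finrank ℂ (K ⊓ LinearMap.ker (π m) : Submodule ℂ V) ≤
            Module.finrank ℂ (F ⊓ LinearMap.ker (gradeTrunc π (m + 1)) : Submodule ℂ V) := by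
          refine Submodule.finrank_mono ?_
          rintro v ⟨⟨hv, hv1⟩, hv2⟩
          refine ⟨hv, ?_⟩
          rw [SetLike.mem_coe, LinearMap.mem_ker] at hv1 hv2 ⊢
          rw [gradeTrunc_succ, hv1, hv2, add_zero]
        omega
  constructor
  · obtain ⟨H, hHF, -, h2, h3⟩ := key N
    have hbot : (F ⊓ LinearMap.ker (gradeTrunc π N) : Submodule ℂ V) = ⊥ := by
      rw [eq_bot_iff]
      rintro v ⟨-, hv⟩
      rw [SetLike.mem_coe, LinearMap.mem_ker, h.trunc_top] at hv
      exact (Submodule.mem_bot ℂ).2 hv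
    rw [hbot, finrank_bot] at h3
    have : H = F' := Submodule.eq_of_le_of_finrank_le hHF (by omega)
    exact this ▸ h2
  · intro m
    obtain ⟨H, hHF, h1, -, h3⟩ := key m
    have h4 := finrank_map_add_finrank_inf_ker (gradeTrunc π m) F
    have h5 : H ≤ F'.map (gradeTrunc π m) := fun v hv => ⟨v, hHF hv, h1 v hv⟩
    have h6 := Submodule.finrank_mono h5
    omega

variable [TopologicalSpace V] [IsTopologicalAddGroup V] [ContinuousSMul ℂ V] [T2Space V]

/-- The limit of the subspaces `t · F` as `t` tends to `0` in the torus. -/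
theorem IsGrading.exists_torusLimit (h : IsGrading N π) {𝒢 : Set (Submodule ℂ V)} {d : ℕ}
    (hd : ∀ F ∈ 𝒢, Module.finrank ℂ F = d)
    (hlim : ∀ (F : ℕ → Submodule ℂ V) (G : Submodule ℂ V), (∀ n, F n ∈ 𝒢) →
      Module.finrank ℂ G = d → IsSubspaceLimit F G → G ∈ 𝒢)
    (htorus : ∀ F ∈ 𝒢, ∀ t : ℂ, t ≠ 0 → F.map (gradeTorus N π t) ∈ 𝒢)
    {F : Submodule ℂ V} (hF : F ∈ 𝒢) :
    ∃ F' ∈ 𝒢, ∀ j, ∀ f ∈ F, gradeTrunc π j f = 0 → π j f ∈ F' := by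
  let t : ℕ → ℂ := fun n => 1 / ((n : ℂ) + 1)
  have ht : Tendsto t atTop (𝓝 0) := tendsto_one_div_add_atTop_nhds_zero_nat
  have ht0 : ∀ n, t n ≠ 0 := fun n => one_div_ne_zero (by exact_mod_cast Nat.succ_ne_zero n)
  have hmem : ∀ n, F.map (gradeTorus N π (t n)) ∈ 𝒢 := fun n => htorus F hF _ (ht0 n)
  obtain ⟨φ, hφ, G, hG, hFG⟩ := exists_subspaceLimit (fun n => F.map (gradeTorus N π (t n)))
    fun n => hd _ (hmem n)
  refine ⟨G, hlim _ G (fun n => hmem (φ n)) hG hFG, fun j f hf hfj => ?_⟩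
  have hlow : ∀ i < j, π i f = 0 := by
    intro i hi
    have h1 : π i (gradeTrunc π j f) = π i f := by
      simp only [gradeTrunc, LinearMap.sum_apply, map_sum]
      rw [Finset.sum_eq_single i]
      · exact h.comp_self i f
      · exact fun b _ hb => h.comp_of_ne _ _ _ hb.symm
      · exact fun hn => absurd (Finset.mem_range.2 hi) hn
    rw [← h1, hfj, map_zero]
  by_cases hjN : j < N
  swap
  · have : π j f = 0 := by
      rw [← h.trunc_top f, h.proj_trunc_of_le (not_lt.1 hjN)]
    rw [this]
    exact G.zero_mem
  refine hFG.2 (fun n => (t (φ n) ^ j)⁻¹ • gradeTorus N π (t (φ n)) f) _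
    (fun n => Submodule.smul_mem _ _ (Submodule.mem_map_of_mem hf)) ?_
  have hrw : ∀ n, (t (φ n) ^ j)⁻¹ • gradeTorus N π (t (φ n)) f =
      ∑ i ∈ Finset.range N, t (φ n) ^ (i - j) • π i f := by
    intro n
    simp only [gradeTorus, LinearMap.sum_apply, LinearMap.smul_apply, Finset.smul_sum, smul_smul]
    refine Finset.sum_congr rfl fun i _ => ?_
    by_cases hi : i < j
    · rw [hlow i hi, smul_zero, smul_zero]
    · rw [pow_sub₀ _ (ht0 _) (not_lt.1 hi), mul_comm]
  simp only [hrw]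
  have hsum : π j f = ∑ i ∈ Finset.range N, (if i = j then (1 : ℂ) else 0) • π i f := by
    simp [Finset.sum_ite_eq', hjN]
  rw [hsum]
  refine tendsto_finsetSum _ fun i _ => ?_
  by_cases hi : i < j
  · simp [hlow i hi]
  by_cases hij : i = j
  · subst hij
    simp
  · rw [if_neg hij]
    have : i - j ≠ 0 := by omega
    have h2 := ((ht.comp hφ.tendsto_atTop).pow (i - j)).smul_const (π i f)
    simpa [this] using h2

theorem eventually_finrank_map_le {l : Filter ℂ} (L : ℂ → Module.End ℂ V) (L₀ : Module.End ℂ V)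
    (hL : ∀ v, Tendsto (fun t => L t v) l (𝓝 (L₀ v))) (F : Submodule ℂ V) :
    ∀ᶠ t in l, Module.finrank ℂ (F.map L₀) ≤ Module.finrank ℂ (F.map (L t)) := by
  let b := Module.finBasis ℂ (F.map L₀)
  have hb : ∀ i, ∃ v ∈ F, L₀ v = b i := fun i => (b i).2
  choose v hv hvb using hb
  have hli : LinearIndependent ℂ fun i => L₀ (v i) := by
    simp only [hvb]
    exact b.linearIndependent.map' (F.map L₀).subtype (Submodule.ker_subtype _)
  exact eventually_le_finrank (x := fun t i => L t (v i)) (tendsto_pi_nhds.2 fun i => hL (v i)) hli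
    (Eventually.of_forall fun t i => Submodule.mem_map_of_mem (hv i))

/-- A Borel fixed point theorem for a closed family of subspaces that is stable under a torus and
under unipotents which strictly lower the degree. A member of the family is chosen that is as large
as possible in low degrees. It may be taken homogeneous; if it was not stable under some `E k`, then
a small motion along the corresponding unipotent would make it larger in low degrees. -/
theorem IsGrading.exists_borelFixed (h : IsGrading N π) {𝒢 : Set (Submodule ℂ V)} {d : ℕ}
    (hd : ∀ F ∈ 𝒢, Module.finrank ℂ F = d) (hne : 𝒢.Nonempty)
    (hlim : ∀ (F : ℕ → Submodule ℂ V) (G : Submodule ℂ V), (∀ n, F n ∈ 𝒢) →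
      Module.finrank ℂ G = d → IsSubspaceLimit F G → G ∈ 𝒢)
    (htorus : ∀ F ∈ 𝒢, ∀ t : ℂ, t ≠ 0 → F.map (gradeTorus N π t) ∈ 𝒢)
    {κ : Type*} (E E' : κ → Module.End ℂ V)
    (hunip : ∀ k, ∀ F ∈ 𝒢, ∀ t : ℂ, F.map (1 + t • E k + t ^ 2 • E' k) ∈ 𝒢)
    (hE : ∀ k j v, π j v = v → gradeTrunc π j (E k v) = E k v) :
    ∃ F ∈ 𝒢, (∀ f ∈ F, ∀ j, π j f ∈ F) ∧ ∀ k, ∀ f ∈ F, E k f ∈ F := by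
  let R : Submodule ℂ V → ℕ := fun F =>
    ∑ m ∈ Finset.range N, Module.finrank ℂ (F.map (gradeTrunc π m))
  have hbdd : BddAbove (R '' 𝒢) := by
    refine ⟨∑ _m ∈ Finset.range N, Module.finrank ℂ V, ?_⟩
    rintro _ ⟨F, -, rfl⟩
    exact Finset.sum_le_sum fun m _ => Submodule.finrank_le _
  obtain ⟨F₀, hF₀, hF₀R⟩ := Nat.sSup_mem (hne.image R) hbdd
  have hmax : ∀ F ∈ 𝒢, R F ≤ R F₀ := fun F hF => hF₀R ▸ le_csSup hbdd (Set.mem_image_of_mem R hF)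
  obtain ⟨F, hF, hlow⟩ := h.exists_torusLimit hd hlim htorus hF₀
  obtain ⟨hhom, hRF⟩ := h.homogeneous_of_lowest_mem ((hd F hF).trans (hd F₀ hF₀).symm) hlow
  have hmaxF : ∀ F' ∈ 𝒢, R F' ≤ R F := fun F' hF' =>
    (hmax F' hF').trans (Finset.sum_le_sum fun m _ => hRF m)
  refine ⟨F, hF, hhom, fun k f₀ hf₀ => ?_⟩
  by_contra hcon
  obtain ⟨j, hjN, hj⟩ : ∃ j < N, E k (π j f₀) ∉ F := by
    by_contra! hall
    apply hcon
    rw [← h.sum_eq f₀, map_sum]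
    exact Submodule.sum_mem _ fun j hj => hall j (Finset.mem_range.1 hj)
  set f := π j f₀ with hfdef
  have hfF : f ∈ F := hhom f₀ hf₀ j
  have hπf : π j f = f := h.comp_self j f₀
  let u : ℂ → Module.End ℂ V := fun t => 1 + t • E k + t ^ 2 • E' k
  have hu : ∀ t v, u t v = v + t • E k v + t ^ 2 • E' k v := fun t v => by simp [u]
  have hcont : ∀ (m : ℕ) (v : V), Tendsto (fun t => (gradeTrunc π m ∘ₗ u t) v) (𝓝[≠] 0)
      (𝓝 (gradeTrunc π m v)) := by
    intro m v
    have h1 : Continuous fun t : ℂ => (gradeTrunc π m ∘ₗ u t) v := by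
      simp only [LinearMap.comp_apply, hu, map_add, map_smul]
      fun_prop
    have h2 := h1.tendsto 0
    simp only [LinearMap.comp_apply, hu] at h2 ⊢
    simpa using h2.mono_left nhdsWithin_le_nhds
  have hge : ∀ m, ∀ᶠ t in 𝓝[≠] (0 : ℂ), Module.finrank ℂ (F.map (gradeTrunc π m)) ≤
      Module.finrank ℂ ((F.map (u t)).map (gradeTrunc π m)) := by
    intro m
    have h1 := eventually_finrank_map_le _ _ (hcont m) F
    filter_upwards [h1] with t ht
    rwa [Submodule.map_comp] at ht
  -- The image of `t⁻¹ • f` under `u t` is `t⁻¹ • f + E k f + …`. Truncation removes the first summand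
  -- and leaves a new vector, close to `E k f`, in degrees less than `j`.
  have hgt : ∀ᶠ t in 𝓝[≠] (0 : ℂ), Module.finrank ℂ (F.map (gradeTrunc π j)) + 1 ≤
      Module.finrank ℂ ((F.map (u t)).map (gradeTrunc π j)) := by
    have hle : F.map (gradeTrunc π j) ≤ F := by
      rintro _ ⟨v, hv, rfl⟩
      simp only [gradeTrunc, LinearMap.sum_apply]
      exact Submodule.sum_mem _ fun i _ => hhom v hv i
    let b := Module.finBasis ℂ (F.map (gradeTrunc π j))
    have hbt : ∀ i, gradeTrunc π j (b i : V) = b i := by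
      intro i
      obtain ⟨v, -, hvb⟩ := (b i).2
      rw [← hvb, h.trunc_trunc]
    let x : ℂ → Fin (Module.finrank ℂ (F.map (gradeTrunc π j)) + 1) → V := fun t =>
      Fin.cons (gradeTrunc π j (E k f) + t • gradeTrunc π j (E' k f))
        (fun i => gradeTrunc π j (u t (b i)))
    have hli : LinearIndependent ℂ (Fin.cons (E k f) (fun i => (b i : V)) :
        Fin (Module.finrank ℂ (F.map (gradeTrunc π j)) + 1) → V) := by
      rw [linearIndependent_finCons]
      refine ⟨b.linearIndependent.map' (F.map (gradeTrunc π j)).subtype (Submodule.ker_subtype _),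
        fun hmem => hj ?_⟩
      exact Submodule.span_le.2 (by rintro _ ⟨i, rfl⟩; exact hle (b i).2) hmem
    refine eventually_le_finrank (x := x) (tendsto_pi_nhds.2 fun i => ?_) hli ?_
    · refine Fin.cases ?_ (fun i => ?_) i
      · have h1 : Continuous fun t : ℂ =>
            gradeTrunc π j (E k f) + t • gradeTrunc π j (E' k f) := by fun_prop
        have h2 := (h1.tendsto 0).mono_left (nhdsWithin_le_nhds (s := {0}ᶜ))
        simpa [x, hE k j f hπf] using h2
      · simpa [x, hbt i] using hcont j (b i)
    · filter_upwards [self_mem_nhdsWithin] with t ht i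
      have ht0 : t ≠ 0 := ht
      refine Fin.cases ?_ (fun i => ?_) i
      · refine ⟨u t (t⁻¹ • f), Submodule.mem_map_of_mem (Submodule.smul_mem _ _ hfF), ?_⟩
        have hf0 : gradeTrunc π j f = 0 := by rw [← hπf, h.trunc_proj_of_le le_rfl]
        simp only [x, Fin.cons_zero, hu, map_add, map_smul, hf0, smul_smul]
        rw [mul_inv_cancel₀ ht0, show t ^ 2 * t⁻¹ = t by field_simp]
        simp
      · exact ⟨u t (b i), Submodule.mem_map_of_mem (hle (b i).2), by simp [x]⟩
  have hall : ∀ᶠ t in 𝓝[≠] (0 : ℂ), ∀ m ∈ Finset.range N,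
      Module.finrank ℂ (F.map (gradeTrunc π m)) ≤
      Module.finrank ℂ ((F.map (u t)).map (gradeTrunc π m)) :=
    (Finset.eventually_all _).2 fun m _ => hge m
  obtain ⟨t, ht1, ht2⟩ := (hall.and hgt).exists
  have hlt : R F < R (F.map (u t)) :=
    Finset.sum_lt_sum ht1 ⟨j, Finset.mem_range.2 hjN, ht2⟩
  exact absurd (hmaxF _ (hunip k F hF t)) (not_le.2 hlt)

end Borel

/-! ### Border apolarity -/

section Map₂

variable {V X Y : Type*} [AddCommGroup V] [Module ℂ V] [AddCommGroup X] [Module ℂ X]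
  [AddCommGroup Y] [Module ℂ Y] [FiniteDimensional ℂ Y]

theorem finrank_map₂_map_le (W : V →ₗ[ℂ] X →ₗ[ℂ] Y) (F : Submodule ℂ V) (g : V →ₗ[ℂ] V)
    (h : X →ₗ[ℂ] X) (hh : Function.Surjective h) (k : Y →ₗ[ℂ] Y)
    (hk : ∀ v x, W (g v) (h x) = k (W v x)) :
    Module.finrank ℂ (Submodule.map₂ W (F.map g) ⊤) ≤ Module.finrank ℂ (Submodule.map₂ W F ⊤) := by
  have hle : Submodule.map₂ W (F.map g) ⊤ ≤ (Submodule.map₂ W F ⊤).map k := by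
    rw [Submodule.map₂_le]
    rintro _ ⟨v, hv, rfl⟩ x -
    obtain ⟨x, rfl⟩ := hh x
    rw [hk]
    exact Submodule.mem_map_of_mem (Submodule.apply_mem_map₂ _ hv Submodule.mem_top)
  exact (Submodule.finrank_mono hle).trans (Submodule.finrank_map_le _ _)

variable [TopologicalSpace V] [IsTopologicalAddGroup V] [ContinuousSMul ℂ V] [T2Space V]
  [FiniteDimensional ℂ V] [TopologicalSpace Y] [IsTopologicalAddGroup Y] [ContinuousSMul ℂ Y]
  [T2Space Y]

theorem IsSubspaceLimit.finrank_map₂_le {F : ℕ → Submodule ℂ V} {G : Submodule ℂ V}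
    (hFG : IsSubspaceLimit F G) (W : V →ₗ[ℂ] X →ₗ[ℂ] Y) {r : ℕ}
    (hF : ∀ n, Module.finrank ℂ (Submodule.map₂ W (F n) ⊤) ≤ r) :
    Module.finrank ℂ (Submodule.map₂ W G ⊤) ≤ r := by
  have hspan : Submodule.map₂ W G ⊤ =
      Submodule.span ℂ (Set.image2 (fun m n => W m n) (G : Set V) ((⊤ : Submodule ℂ X) : Set X)) :=
    Submodule.map₂_eq_span_image2 W G ⊤
  obtain ⟨y, hy, -, hli⟩ := Submodule.exists_fun_fin_finrank_span_eq ℂ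
    (Set.image2 (fun m n => W m n) (G : Set V) ((⊤ : Submodule ℂ X) : Set X))
  rw [hspan]
  choose g hg x _ hgx using hy
  choose f hfF hfg using fun i => hFG.1 (g i) (hg i)
  have hlim : Tendsto (fun n i => W (f i n) (x i)) atTop (𝓝 y) := by
    refine tendsto_pi_nhds.2 fun i => ?_
    rw [← hgx i]
    exact ((W.flip (x i)).continuous_of_finiteDimensional.tendsto (g i)).comp (hfg i)
  obtain ⟨n, hn⟩ := (eventually_le_finrank hlim hli (W := fun n => Submodule.map₂ W (F n) ⊤)
    (Eventually.of_forall fun n i =>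
      Submodule.apply_mem_map₂ _ (hfF i n) Submodule.mem_top)).exists
  exact hn.trans (hF n)

end Map₂

section Wedge

variable {α β : Type*}

/-- The contribution of `f ⊗ v ∈ (A ⊗ B) ⊗ A` to `Λ²A ⊗ B`, the exterior square being realized as
the space of alternating matrices. -/
def wedge {R : Type*} [Ring R] (f : Matrix α β R) (v : α → R) : α → α → β → R :=
  fun i i' j => f i j * v i' - f i' j * v i

/-- `wedge` as a bilinear map. -/
def wedgeₗ (α β : Type*) : Matrix α β ℂ →ₗ[ℂ] (α → ℂ) →ₗ[ℂ] (α → α → β → ℂ) :=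
  LinearMap.mk₂ ℂ wedge
    (fun f f' v => by funext i i' j; simp only [wedge, Matrix.add_apply, Pi.add_apply]; ring)
    (fun c f v => by
      funext i i' j; simp only [wedge, Matrix.smul_apply, Pi.smul_apply, smul_eq_mul]; ring)
    (fun f v v' => by funext i i' j; simp only [wedge, Pi.add_apply]; ring)
    (fun c f v => by funext i i' j; simp only [wedge, Pi.smul_apply, smul_eq_mul]; ring)

/-- The image of `F ⊗ A` in `Λ²A ⊗ B`, for a subspace `F` of `A ⊗ B`. -/
def wedgeSpan (F : Submodule ℂ (Matrix α β ℂ)) : Submodule ℂ (α → α → β → ℂ) :=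
  Submodule.map₂ (wedgeₗ α β) F ⊤

/-- The subspace of `B ⊗ A` corresponding to a subspace of `A ⊗ B`. -/
def transposeSubmodule (F : Submodule ℂ (Matrix α β ℂ)) : Submodule ℂ (Matrix β α ℂ) :=
  F.map (Matrix.transposeLinearEquiv α β ℂ ℂ).toLinearMap

theorem mem_transposeSubmodule {F : Submodule ℂ (Matrix α β ℂ)} {f : Matrix α β ℂ} (hf : f ∈ F) :
    f.transpose ∈ transposeSubmodule F :=
  Submodule.mem_map_of_mem (f := (Matrix.transposeLinearEquiv α β ℂ ℂ).toLinearMap) hf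

theorem IsSubspaceLimit.transposeSubmodule {F : ℕ → Submodule ℂ (Matrix α β ℂ)}
    {G : Submodule ℂ (Matrix α β ℂ)} (h : IsSubspaceLimit F G) :
    IsSubspaceLimit (fun n => transposeSubmodule (F n)) (transposeSubmodule G) := by
  constructor
  · rintro _ ⟨g, hg, rfl⟩
    obtain ⟨f, hf, hfg⟩ := h.1 g hg
    exact ⟨fun n => (f n).transpose, fun n => mem_transposeSubmodule (hf n),
      ((continuous_id.matrix_transpose).tendsto g).comp hfg⟩
  · intro f g hf hg
    have h1 : g.transpose ∈ G := by
      refine h.2 (fun n => (f n).transpose) _ (fun n => ?_)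
        (((continuous_id.matrix_transpose).tendsto g).comp hg)
      obtain ⟨v, hv, hvf⟩ := hf n
      rw [← hvf]
      exact hv
    exact mem_transposeSubmodule h1

variable [Fintype α] [Fintype β]

theorem finrank_wedgeSpan_sup_span_le (F : Submodule ℂ (Matrix α β ℂ)) {a : α → ℂ} (b : β → ℂ)
    (ha : a ≠ 0) :
    Module.finrank ℂ (wedgeSpan (F ⊔ Submodule.span ℂ {Matrix.vecMulVec a b})) ≤
      Module.finrank ℂ (wedgeSpan F) + (Fintype.card α - 1) := by
  rw [wedgeSpan, Submodule.map₂_sup_left, Submodule.map₂_span_singleton_eq_map]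
  refine (Submodule.finrank_add_le_finrank_add_finrank _ _).trans ?_
  refine Nat.add_le_add le_rfl ?_
  rw [Submodule.map_top]
  have h1 := LinearMap.finrank_range_add_finrank_ker (wedgeₗ α β (Matrix.vecMulVec a b))
  have h2 : a ∈ LinearMap.ker (wedgeₗ α β (Matrix.vecMulVec a b)) := by
    rw [LinearMap.mem_ker]
    funext i i' j
    simp only [wedgeₗ, LinearMap.mk₂_apply, wedge, Matrix.vecMulVec_apply, Pi.zero_apply]
    ring
  have h3 : 0 < Module.finrank ℂ (LinearMap.ker (wedgeₗ α β (Matrix.vecMulVec a b))) :=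
    Module.finrank_pos_iff_exists_ne_zero.2 ⟨⟨a, h2⟩, by simpa [Subtype.ext_iff] using ha⟩
  rw [Module.finrank_fintype_fun_eq_card] at h1
  omega

/-- The dimension bounds satisfied by a span of linearly independent matrices of rank one. -/
def HasWedgeBounds (F : Submodule ℂ (Matrix α β ℂ)) : Prop :=
  Module.finrank ℂ (wedgeSpan F) ≤ Module.finrank ℂ F * (Fintype.card α - 1) ∧
    Module.finrank ℂ (wedgeSpan (transposeSubmodule F)) ≤
      Module.finrank ℂ F * (Fintype.card β - 1)

/-- Adding a tensor `a ⊗ b` of rank one enlarges the image in `Λ²A ⊗ B` by at most `dim A - 1`,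
because `a ∧ a = 0`, and symmetrically for `B`. -/
theorem HasWedgeBounds.sup_span {F : Submodule ℂ (Matrix α β ℂ)} (hF : HasWedgeBounds F)
    {a : α → ℂ} {b : β → ℂ} (hab : Matrix.vecMulVec a b ∉ F) :
    HasWedgeBounds (F ⊔ Submodule.span ℂ {Matrix.vecMulVec a b}) ∧
      Module.finrank ℂ (F ⊔ Submodule.span ℂ {Matrix.vecMulVec a b} : Submodule ℂ _) =
        Module.finrank ℂ F + 1 := by
  have hne : Matrix.vecMulVec a b ≠ 0 := fun h => hab (h ▸ F.zero_mem)
  have ha : a ≠ 0 := by rintro rfl; exact hne (Matrix.zero_vecMulVec b)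
  have hb : b ≠ 0 := by rintro rfl; exact hne (by ext; simp [Matrix.vecMulVec_apply])
  have hdim : Module.finrank ℂ (F ⊔ Submodule.span ℂ {Matrix.vecMulVec a b} : Submodule ℂ _) =
      Module.finrank ℂ F + 1 := by
    have h1 := Submodule.finrank_sup_add_finrank_inf_eq F (Submodule.span ℂ {Matrix.vecMulVec a b})
    have h2 : F ⊓ Submodule.span ℂ {Matrix.vecMulVec a b} = ⊥ := by
      rw [eq_bot_iff]
      rintro x ⟨hx, hx'⟩
      obtain ⟨c, rfl⟩ := Submodule.mem_span_singleton.1 hx'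
      by_cases hc : c = 0
      · simp [hc]
      · exact absurd ((F.smul_mem_iff hc).1 hx) hab
    rw [h2, finrank_bot, finrank_span_singleton hne] at h1
    omega
  refine ⟨⟨?_, ?_⟩, hdim⟩
  · rw [hdim, Nat.add_mul, one_mul]
    exact (finrank_wedgeSpan_sup_span_le F b ha).trans (Nat.add_le_add hF.1 le_rfl)
  · have h3 : transposeSubmodule (F ⊔ Submodule.span ℂ {Matrix.vecMulVec a b}) =
        transposeSubmodule F ⊔ Submodule.span ℂ {Matrix.vecMulVec b a} := by
      rw [transposeSubmodule, Submodule.map_sup, Submodule.map_span, Set.image_singleton]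
      congr 3
      exact Matrix.transpose_vecMulVec a b
    rw [hdim, Nat.add_mul, one_mul, h3]
    exact (finrank_wedgeSpan_sup_span_le _ a hb).trans (Nat.add_le_add hF.2 le_rfl)

theorem HasWedgeBounds.exists_ge {F : Submodule ℂ (Matrix α β ℂ)} (hF : HasWedgeBounds F) {r : ℕ}
    (hr : r ≤ Fintype.card α * Fintype.card β) (hFr : Module.finrank ℂ F ≤ r) :
    ∃ G, F ≤ G ∧ HasWedgeBounds G ∧ Module.finrank ℂ G = r := by
  classical
  induction hn : r - Module.finrank ℂ F generalizing F with
  | zero => exact ⟨F, le_rfl, hF, by omega⟩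
  | succ n ih =>
    have hex : ∃ i j, Matrix.vecMulVec (Pi.single i 1 : α → ℂ) (Pi.single j 1 : β → ℂ) ∉ F := by
      by_contra! hall
      have htop : F = ⊤ := by
        rw [eq_top_iff]
        intro f _
        rw [Matrix.matrix_eq_sum_single f]
        refine Submodule.sum_mem _ fun i _ => Submodule.sum_mem _ fun j _ => ?_
        have h1 : Matrix.single i j (f i j) = f i j • Matrix.single i j (1 : ℂ) := by simp
        rw [h1, Matrix.single_eq_single_vecMulVec_single]
        exact F.smul_mem _ (hall i j)
      have h2 : Module.finrank ℂ F = Fintype.card α * Fintype.card β := by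
        rw [htop, finrank_top, Module.finrank_matrix]
        simp
      omega
    obtain ⟨i, j, hij⟩ := hex
    obtain ⟨h1, h2⟩ := hF.sup_span hij
    obtain ⟨G, hG, hG1, hG2⟩ := ih h1 (by omega) (by omega)
    exact ⟨G, le_sup_left.trans hG, hG1, hG2⟩

theorem exists_hasWedgeBounds_of_isSumOfRankOne {γ : Type*} {r : ℕ} {T : α → β → γ → ℂ}
    (hT : IsSumOfRankOne r T) (hr : r ≤ Fintype.card α * Fintype.card β) :
    ∃ F : Submodule ℂ (Matrix α β ℂ), HasWedgeBounds F ∧ Module.finrank ℂ F = r ∧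
      ∀ k, (Matrix.of fun i j => T i j k) ∈ F := by
  obtain ⟨a, b, c, habc⟩ := hT
  have key : ∀ m ≤ r, ∃ F : Submodule ℂ (Matrix α β ℂ), HasWedgeBounds F ∧
      Module.finrank ℂ F ≤ m ∧ ∀ s : Fin r, (s : ℕ) < m → Matrix.vecMulVec (a s) (b s) ∈ F := by
    intro m
    induction m with
    | zero =>
      refine fun _ => ⟨⊥, ⟨?_, ?_⟩, by simp, by simp⟩
      · rw [wedgeSpan, Submodule.map₂_bot_left, finrank_bot]
        exact Nat.zero_le _
      · rw [transposeSubmodule, Submodule.map_bot, wedgeSpan, Submodule.map₂_bot_left, finrank_bot]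
        exact Nat.zero_le _
    | succ m ih =>
      intro hm
      obtain ⟨F, h1, h2, h3⟩ := ih (by omega)
      by_cases hmem : Matrix.vecMulVec (a ⟨m, hm⟩) (b ⟨m, hm⟩) ∈ F
      · refine ⟨F, h1, by omega, fun s hs => ?_⟩
        rcases Nat.lt_succ_iff_lt_or_eq.1 hs with h | h
        · exact h3 s h
        · have : s = ⟨m, hm⟩ := Fin.ext h
          exact this ▸ hmem
      · obtain ⟨h4, h5⟩ := h1.sup_span hmem
        refine ⟨_, h4, by omega, fun s hs => ?_⟩
        rcases Nat.lt_succ_iff_lt_or_eq.1 hs with h | h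
        · exact Submodule.mem_sup_left (h3 s h)
        · have : s = ⟨m, hm⟩ := Fin.ext h
          exact Submodule.mem_sup_right (this ▸ Submodule.mem_span_singleton_self _)
  obtain ⟨F, h1, h2, h3⟩ := key r le_rfl
  obtain ⟨G, hFG, hG1, hG2⟩ := h1.exists_ge hr h2
  refine ⟨G, hG1, hG2, fun k => ?_⟩
  have : (Matrix.of fun i j => T i j k) = ∑ s, c s k • Matrix.vecMulVec (a s) (b s) := by
    ext i j
    simp only [Matrix.of_apply, habc, Matrix.sum_apply, Matrix.smul_apply, Matrix.vecMulVec_apply,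
      smul_eq_mul]
    exact Finset.sum_congr rfl fun s _ => mul_comm _ _
  rw [this]
  exact G.sum_mem fun s _ => G.smul_mem _ (hFG (h3 s s.2))

/-- `F` satisfies the conditions that the limit of the spans of the `a s ⊗ b s` satisfies if the
tensors `∑ s, a s ⊗ b s ⊗ c s` with `r` terms converge to `T`: its dimension is `r`, it contains the
slices of `T`, and the images of `F ⊗ A` in `Λ²A ⊗ B` and of `F ⊗ B` in `A ⊗ Λ²B` are small. -/
structure IsApolar {γ : Type*} (T : α → β → γ → ℂ) (r : ℕ) (F : Submodule ℂ (Matrix α β ℂ)) :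
    Prop where
  finrank_eq : Module.finrank ℂ F = r
  slice_mem : ∀ k, (Matrix.of fun i j => T i j k) ∈ F
  finrank_left : Module.finrank ℂ (wedgeSpan F) ≤ r * (Fintype.card α - 1)
  finrank_right : Module.finrank ℂ (wedgeSpan (transposeSubmodule F)) ≤ r * (Fintype.card β - 1)

theorem isApolar_of_limit {γ : Type*} {r : ℕ} (T : ℕ → α → β → γ → ℂ) (T₀ : α → β → γ → ℂ)
    (hT : Tendsto T atTop (𝓝 T₀)) (F : ℕ → Submodule ℂ (Matrix α β ℂ))
    (G : Submodule ℂ (Matrix α β ℂ)) (hF : ∀ n, IsApolar (T n) r (F n))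
    (hG : Module.finrank ℂ G = r) (hFG : IsSubspaceLimit F G) : IsApolar T₀ r G where
  finrank_eq := hG
  slice_mem k := by
    refine hFG.2 (fun n => Matrix.of fun i j => T n i j k) _ (fun n => (hF n).slice_mem k) ?_
    exact tendsto_pi_nhds.2 fun i => tendsto_pi_nhds.2 fun j =>
      tendsto_pi_nhds.1 (tendsto_pi_nhds.1 (tendsto_pi_nhds.1 hT i) j) k
  finrank_left := hFG.finrank_map₂_le _ fun n => (hF n).finrank_left
  finrank_right := hFG.transposeSubmodule.finrank_map₂_le _ fun n => (hF n).finrank_right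

theorem exists_isApolar {γ : Type*} [Finite γ] {r : ℕ} {T : α → β → γ → ℂ} (hT : borderRank T ≤ r)
    (hr : r ≤ Fintype.card α * Fintype.card β) : ∃ F, IsApolar T r F := by
  cases nonempty_fintype γ
  obtain ⟨T', hT', hlim⟩ := mem_closure_iff_seq_limit.1 (borderRank_le_iff.1 hT)
  choose F hF1 hF2 hF3 using fun n => exists_hasWedgeBounds_of_isSumOfRankOne (hT' n) hr
  have hF : ∀ n, IsApolar (T' n) r (F n) := fun n =>
    ⟨hF2 n, hF3 n, by simpa [hF2 n] using (hF1 n).1, by simpa [hF2 n] using (hF1 n).2⟩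
  obtain ⟨φ, hφ, G, hG, hFG⟩ := exists_subspaceLimit F hF2
  exact ⟨G, isApolar_of_limit (fun n => T' (φ n)) T (hlim.comp hφ.tendsto_atTop) _ G
    (fun n => hF (φ n)) hG hFG⟩

/-- The action of a pair of matrices on `A ⊗ B`. -/
def matrixAct (P : Matrix α α ℂ) (Q : Matrix β β ℂ) : Module.End ℂ (Matrix α β ℂ) where
  toFun f := P * f * Q.transpose
  map_add' f g := by rw [Matrix.mul_add, Matrix.add_mul]
  map_smul' c f := by simp

theorem finrank_wedgeSpan_matrixAct_le [DecidableEq α] {P P' : Matrix α α ℂ} (hP : P * P' = 1)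
    (Q : Matrix β β ℂ) (F : Submodule ℂ (Matrix α β ℂ)) :
    Module.finrank ℂ (wedgeSpan (F.map (matrixAct P Q))) ≤ Module.finrank ℂ (wedgeSpan F) := by
  let k : (α → α → β → ℂ) →ₗ[ℂ] (α → α → β → ℂ) :=
    { toFun := fun y i i' j => ∑ a, ∑ a', ∑ b, P i a * P i' a' * Q j b * y a a' b
      map_add' := fun y z => by
        funext i i' j
        simp only [Pi.add_apply, mul_add, Finset.sum_add_distrib]
      map_smul' := fun c y => by
        funext i i' j
        simp only [Pi.smul_apply, smul_eq_mul, Finset.mul_sum, RingHom.id_apply]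
        exact Finset.sum_congr rfl fun _ _ => Finset.sum_congr rfl fun _ _ =>
          Finset.sum_congr rfl fun _ _ => by ring }
  refine finrank_map₂_map_le (wedgeₗ α β) F (matrixAct P Q) P.mulVecLin ?_ k ?_
  · intro v
    exact ⟨P'.mulVec v, by simp [Matrix.mulVec_mulVec, hP]⟩
  · intro f v
    funext i i' j
    have h1 : ∀ i j, (P * f * Q.transpose) i j = ∑ a, ∑ b, P i a * Q j b * f a b := by
      intro i j
      simp only [Matrix.mul_apply, Matrix.transpose_apply, Finset.sum_mul]
      rw [Finset.sum_comm]
      exact Finset.sum_congr rfl fun _ _ => Finset.sum_congr rfl fun _ _ => by ring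
    have h2 : ∀ i i', (∑ a, ∑ b, P i a * Q j b * f a b) * (∑ a', P i' a' * v a') =
        ∑ a, ∑ a', ∑ b, P i a * P i' a' * Q j b * (f a b * v a') := by
      intro i i'
      rw [Finset.sum_mul_sum]
      refine Finset.sum_congr rfl fun a _ => Finset.sum_congr rfl fun a' _ => ?_
      rw [Finset.sum_mul]
      exact Finset.sum_congr rfl fun b _ => by ring
    simp only [wedgeₗ, LinearMap.mk₂_apply, wedge, matrixAct, LinearMap.coe_mk, AddHom.coe_mk, h1,
      Matrix.mulVecLin_apply, Matrix.mulVec, dotProduct, k, h2]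
    rw [Finset.sum_comm (f := fun a a' => ∑ b, P i' a * P i a' * Q j b * (f a b * v a'))]
    simp only [← Finset.sum_sub_distrib]
    exact Finset.sum_congr rfl fun _ _ => Finset.sum_congr rfl fun _ _ =>
      Finset.sum_congr rfl fun _ _ => by ring

/-- Invertible matrices whose inverses carry the slices of `T` into `F` preserve the conditions. -/
theorem IsApolar.map_matrixAct [DecidableEq α] [DecidableEq β] {γ : Type*} {T : α → β → γ → ℂ}
    {r : ℕ} {F : Submodule ℂ (Matrix α β ℂ)} (hF : IsApolar T r F) {P P' : Matrix α α ℂ}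
    {Q Q' : Matrix β β ℂ} (hP : P * P' = 1) (hQ : Q * Q' = 1)
    (hT : ∀ k, matrixAct P' Q' (Matrix.of fun i j => T i j k) ∈ F) :
    IsApolar T r (F.map (matrixAct P Q)) where
  finrank_eq := by
    have hker : LinearMap.ker (matrixAct P Q) = ⊥ := by
      rw [LinearMap.ker_eq_bot']
      intro f hf
      have hf' : P * f * Q.transpose = 0 := hf
      have h1 : P' * (P * f * Q.transpose) * Q'.transpose = f := by
        have hQ' : Q.transpose * Q'.transpose = 1 := by
          rw [← Matrix.transpose_mul, mul_eq_one_comm.1 hQ, Matrix.transpose_one]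
        rw [← Matrix.mul_assoc, ← Matrix.mul_assoc, mul_eq_one_comm.1 hP, Matrix.mul_assoc, hQ']
        simp
      rw [← h1, hf']
      simp
    have h := finrank_map_add_finrank_inf_ker (matrixAct P Q) F
    rw [hker, inf_bot_eq, finrank_bot, hF.finrank_eq] at h
    exact h
  slice_mem k := by
    refine ⟨_, hT k, ?_⟩
    have hQ' : Q'.transpose * Q.transpose = 1 := by
      rw [← Matrix.transpose_mul, hQ, Matrix.transpose_one]
    simp only [matrixAct, LinearMap.coe_mk, AddHom.coe_mk]
    rw [← Matrix.mul_assoc, ← Matrix.mul_assoc, hP, Matrix.mul_assoc, hQ']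
    simp
  finrank_left := (finrank_wedgeSpan_matrixAct_le hP Q F).trans hF.finrank_left
  finrank_right := by
    have h : transposeSubmodule (F.map (matrixAct P Q)) =
        (transposeSubmodule F).map (matrixAct Q P) := by
      rw [transposeSubmodule, transposeSubmodule, ← Submodule.map_comp, ← Submodule.map_comp]
      congr 1
      ext f : 1
      simp [matrixAct, Matrix.transpose_mul, Matrix.mul_assoc]
    rw [h]
    exact (finrank_wedgeSpan_matrixAct_le hQ P _).trans hF.finrank_right

end Wedge

/-! ### The grading of the sextonion tensor -/

theorem sextonionMatrix_eq_sum {R : Type*} [Ring R] (z : Fin 6 → R) :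
    sextonionMatrix z = ∑ k, z k • sextonionSlice R k := by
  ext i j
  rw [Matrix.sum_apply, Fin.sum_univ_six]
  fin_cases i <;> fin_cases j <;> simp [sextonionSlice, sextonionMatrix]

/-- The degrees of the coordinates in the first factor `A`. Together with `degB` they are chosen such
that every slice of the tensor is homogeneous, the infinitesimal symmetries `raiseA`, `raiseB` lower
the degree, and two distinct positions `(i, j)` have the same total degree only if the same
coordinate appears there in `sextonionMatrix`. -/
def degA : Fin 6 → ℕ := ![0, 6, 2, 8, 18, 17]

/-- The degrees of the coordinates in the second factor `B`. -/
def degB : Fin 6 → ℕ := ![6, 7, 0, 1, 16, 18]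

/-- The projections to the homogeneous components of `A ⊗ B`. -/
def degProj (h : ℕ) : Module.End ℂ (Matrix (Fin 6) (Fin 6) ℂ) where
  toFun f := Matrix.of fun i j => if degA i + degB j = h then f i j else 0
  map_add' f g := by
    ext i j
    by_cases h1 : degA i + degB j = h <;> simp [h1]
  map_smul' c f := by
    ext i j
    by_cases h1 : degA i + degB j = h <;> simp [h1]

theorem degProj_apply (h : ℕ) (f : Matrix (Fin 6) (Fin 6) ℂ) (i j : Fin 6) :
    degProj h f i j = if degA i + degB j = h then f i j else 0 := rfl

theorem deg_lt (i j : Fin 6) : degA i + degB j < 37 := by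
  revert i j
  decide

theorem isGrading_degProj : IsGrading 37 degProj where
  comp_self h f := by
    ext i j
    by_cases h1 : degA i + degB j = h <;> simp [degProj_apply, h1]
  comp_of_ne h h' f hne := by
    ext i j
    by_cases h1 : degA i + degB j = h
    · have : h ≠ h' := hne
      simp [degProj_apply, h1, this]
    · simp [degProj_apply, h1]
  sum_eq f := by
    ext i j
    simp [Matrix.sum_apply, degProj_apply, deg_lt i j]

theorem gradeTrunc_degProj_apply (m : ℕ) (f : Matrix (Fin 6) (Fin 6) ℂ) (i j : Fin 6) :
    gradeTrunc degProj m f i j = if degA i + degB j < m then f i j else 0 := by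
  simp [gradeTrunc, Matrix.sum_apply, degProj_apply]

theorem gradeTorus_degProj (t : ℂ) : gradeTorus 37 degProj t =
    matrixAct (Matrix.diagonal fun i => t ^ degA i) (Matrix.diagonal fun j => t ^ degB j) := by
  ext f i j
  have h := deg_lt i j
  simp [gradeTorus, Matrix.sum_apply, degProj_apply, matrixAct, Matrix.diagonal_transpose,
    Matrix.mul_diagonal, Matrix.diagonal_mul, h, pow_add]
  ring

/-! ### Unipotent symmetries of the sextonion tensor -/

/-- The action on `A` of four infinitesimal symmetries of square zero of the tensor. The first three
are raising operators of three commuting copies of `𝔰𝔩₂`, and the fourth takes the last two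
coordinates to the first four. -/
def raiseA : Fin 4 → Matrix (Fin 6) (Fin 6) ℤ :=
  ![Matrix.single 0 2 1 + Matrix.single 1 3 1, Matrix.single 5 4 (-1),
    Matrix.single 0 1 1 + Matrix.single 2 3 1, Matrix.single 3 5 1]

/-- The action on `B` of the infinitesimal symmetries of `raiseA`. -/
def raiseB : Fin 4 → Matrix (Fin 6) (Fin 6) ℤ :=
  ![Matrix.single 4 5 1, Matrix.single 0 1 1 + Matrix.single 2 3 1,
    Matrix.single 2 0 (-1) + Matrix.single 3 1 (-1), Matrix.single 1 4 (-1)]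

/-- The action on `A ⊗ B` of the infinitesimal symmetries of `raiseA`. -/
def raiseAB (k : Fin 4) : Module.End ℂ (Matrix (Fin 6) (Fin 6) ℂ) where
  toFun f := (raiseA k).map (Int.cast : ℤ → ℂ) * f +
    f * ((raiseB k).map (Int.cast : ℤ → ℂ)).transpose
  map_add' f g := by rw [Matrix.mul_add, Matrix.add_mul]; abel
  map_smul' c f := by simp

/-- The second order term in the action on `A ⊗ B` of the one-parameter group generated by
`raiseAB k`. -/
def raiseAB₂ (k : Fin 4) : Module.End ℂ (Matrix (Fin 6) (Fin 6) ℂ) :=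
  matrixAct ((raiseA k).map (Int.cast : ℤ → ℂ)) ((raiseB k).map (Int.cast : ℤ → ℂ))

theorem matrixAct_one_add (k : Fin 4) (t : ℂ) :
    matrixAct (1 + t • (raiseA k).map (Int.cast : ℤ → ℂ))
      (1 + t • (raiseB k).map (Int.cast : ℤ → ℂ)) = 1 + t • raiseAB k + t ^ 2 • raiseAB₂ k := by
  refine LinearMap.ext fun f => ?_
  simp only [matrixAct, raiseAB, raiseAB₂, LinearMap.coe_mk, AddHom.coe_mk, LinearMap.add_apply,
    LinearMap.smul_apply, Module.End.one_apply, Matrix.transpose_add, Matrix.transpose_smul,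
    Matrix.transpose_one, Matrix.add_mul, Matrix.mul_add, Matrix.one_mul, Matrix.mul_one,
    Matrix.smul_mul, Matrix.mul_smul, smul_add, smul_smul, pow_two]
  abel

theorem raise_mul_self (k : Fin 4) :
    (raiseA k).map (Int.cast : ℤ → ℂ) * (raiseA k).map (Int.cast : ℤ → ℂ) = 0 ∧
      (raiseB k).map (Int.cast : ℤ → ℂ) * (raiseB k).map (Int.cast : ℤ → ℂ) = 0 := by
  have h : raiseA k * raiseA k = 0 ∧ raiseB k * raiseB k = 0 := by
    revert k
    decide
  have hc : ∀ M : Matrix (Fin 6) (Fin 6) ℤ, M * M = 0 →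
      M.map (Int.cast : ℤ → ℂ) * M.map (Int.cast : ℤ → ℂ) = 0 := by
    intro M hM
    have h1 := Matrix.map_mul (L := M) (M := M) (f := Int.castRingHom ℂ)
    rw [hM] at h1
    simpa using h1.symm
  exact ⟨hc _ h.1, hc _ h.2⟩

/-- `raiseAB` on matrices with integral entries. -/
def raiseInt (k : Fin 4) (f : Matrix (Fin 6) (Fin 6) ℤ) : Matrix (Fin 6) (Fin 6) ℤ :=
  raiseA k * f + f * (raiseB k).transpose

theorem raiseAB_map (k : Fin 4) (f : Matrix (Fin 6) (Fin 6) ℤ) :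
    raiseAB k (f.map (Int.cast : ℤ → ℂ)) = (raiseInt k f).map (Int.cast : ℤ → ℂ) := by
  have h1 : ∀ M N : Matrix (Fin 6) (Fin 6) ℤ, M.map (Int.cast : ℤ → ℂ) * N.map (Int.cast : ℤ → ℂ) =
      (M * N).map (Int.cast : ℤ → ℂ) := fun M N =>
    (Matrix.map_mul (L := M) (M := N) (f := Int.castRingHom ℂ)).symm
  simp only [raiseAB, raiseInt, LinearMap.coe_mk, AddHom.coe_mk]
  rw [h1, ← Matrix.transpose_map, h1]
  ext i j
  simp

theorem sextonionSlice_map (k : Fin 6) :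
    sextonionSlice ℂ k = (sextonionSlice ℤ k).map (Int.cast : ℤ → ℂ) := by
  ext i j
  exact sextonionSlice_cast k i j

theorem IsApolar.sextonionMatrix_mem {r : ℕ} {F : Submodule ℂ (Matrix (Fin 6) (Fin 6) ℂ)}
    (hF : IsApolar sextonionTensor r F) (z : Fin 6 → ℂ) : sextonionMatrix z ∈ F := by
  rw [sextonionMatrix_eq_sum]
  exact F.sum_mem fun k _ => F.smul_mem _ (hF.slice_mem k)

/-- The span of the slices is stable under the infinitesimal symmetries, and their second order
terms vanish on it. -/
theorem IsApolar.raise_slice_mem {r : ℕ} {F : Submodule ℂ (Matrix (Fin 6) (Fin 6) ℂ)}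
    (hF : IsApolar sextonionTensor r F) (g : Fin 4) (k : Fin 6) :
    raiseAB g (sextonionSlice ℂ k) ∈ F ∧ raiseAB₂ g (sextonionSlice ℂ k) = 0 := by
  constructor
  · have h : raiseInt g (sextonionSlice ℤ k) =
        ((![![0, 0, 1, 1, 0, 0], ![0, 1, 0, 1, 0, 0], ![0, 0, 0, 0, -1, 0], ![0, 0, 0, 0, 0, 1]] :
          Fin 4 → Fin 6 → ℤ) g k) • sextonionSlice ℤ ((![![0, 0, 0, 1, 0, 0], ![0, 0, 0, 2, 0, 0],
            ![0, 0, 0, 0, 5, 0], ![0, 0, 0, 0, 0, 3]] : Fin 4 → Fin 6 → Fin 6) g k) := by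
      revert g k
      decide
    rw [sextonionSlice_map, raiseAB_map, h, Matrix.map_smul' _ _ _ (by simp), ← sextonionSlice_map]
    exact F.smul_mem _ (hF.slice_mem _)
  · have h : raiseA g * sextonionSlice ℤ k * (raiseB g).transpose = 0 := by
      revert g k
      decide
    have h2 := congrArg (fun M => M.map (Int.castRingHom ℂ)) h
    simp only [Matrix.map_mul, Matrix.transpose_map] at h2
    rw [sextonionSlice_map]
    refine Eq.trans ?_ (h2.trans ?_)
    · rfl
    · ext i j
      simp

/-- The conditions of `IsApolar` can be satisfied by a subspace that is fixed by the torus and by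
the unipotent symmetries. -/
theorem exists_isApolar_stable {r : ℕ} {F₀ : Submodule ℂ (Matrix (Fin 6) (Fin 6) ℂ)}
    (hF₀ : IsApolar sextonionTensor r F₀) :
    ∃ F, IsApolar sextonionTensor r F ∧ (∀ f ∈ F, ∀ h, degProj h f ∈ F) ∧
      ∀ k, ∀ f ∈ F, raiseAB k f ∈ F := by
  refine isGrading_degProj.exists_borelFixed (𝒢 := {F | IsApolar sextonionTensor r F}) (d := r)
    (fun F hF => hF.finrank_eq) ⟨F₀, hF₀⟩ ?_ ?_ raiseAB raiseAB₂ ?_ ?_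
  · intro F G hF hG hFG
    exact isApolar_of_limit (fun _ => sextonionTensor) _ tendsto_const_nhds F G hF hG hFG
  · intro F hF t ht
    rw [gradeTorus_degProj]
    refine IsApolar.map_matrixAct (P' := Matrix.diagonal fun i => (t ^ degA i)⁻¹)
      (Q' := Matrix.diagonal fun j => (t ^ degB j)⁻¹) hF ?_ ?_ fun k => ?_
    · rw [Matrix.diagonal_mul_diagonal, ← Matrix.diagonal_one]
      congr 1
      funext i
      exact mul_inv_cancel₀ (pow_ne_zero _ ht)
    · rw [Matrix.diagonal_mul_diagonal, ← Matrix.diagonal_one]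
      congr 1
      funext i
      exact mul_inv_cancel₀ (pow_ne_zero _ ht)
    · have hdeg : ∀ i j, sextonionSlice ℤ k i j ≠ 0 →
          degA i + degB j = (![6, 7, 8, 9, 24, 18] : Fin 6 → ℕ) k := by
        have h : ∀ k i j, decide (sextonionSlice ℤ k i j = 0) ||
            decide (degA i + degB j = (![6, 7, 8, 9, 24, 18] : Fin 6 → ℕ) k) := by
          decide
        intro i j hij
        simpa [hij] using h k i j
      have hs : matrixAct (Matrix.diagonal fun i => (t ^ degA i)⁻¹)
          (Matrix.diagonal fun j => (t ^ degB j)⁻¹) (sextonionSlice ℂ k) =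
            (t ^ (![6, 7, 8, 9, 24, 18] : Fin 6 → ℕ) k)⁻¹ • sextonionSlice ℂ k := by
        ext i j
        by_cases h0 : sextonionSlice ℤ k i j = 0
        · simp [matrixAct, Matrix.diagonal_transpose, Matrix.mul_diagonal, Matrix.diagonal_mul,
            sextonionSlice_cast, h0]
        · rw [← hdeg i j h0]
          simp only [matrixAct, LinearMap.coe_mk, AddHom.coe_mk, Matrix.diagonal_transpose,
            Matrix.mul_diagonal, Matrix.diagonal_mul, Matrix.smul_apply, smul_eq_mul, pow_add,
            mul_inv]
          ring
      have h1 : (Matrix.of fun i j => sextonionTensor i j k) = sextonionSlice ℂ k := rfl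
      rw [h1, hs]
      exact F.smul_mem _ (hF.slice_mem k)
  · intro g F hF t
    change IsApolar sextonionTensor r _
    rw [← matrixAct_one_add]
    obtain ⟨hA, hB⟩ := raise_mul_self g
    have hinv : ∀ M : Matrix (Fin 6) (Fin 6) ℂ, M * M = 0 → (1 + t • M) * (1 + (-t) • M) = 1 := by
      intro M hM
      simp [Matrix.add_mul, Matrix.mul_add, hM]
    refine hF.map_matrixAct (hinv _ hA) (hinv _ hB) fun k => ?_
    rw [matrixAct_one_add]
    have h1 : (Matrix.of fun i j => sextonionTensor i j k) = sextonionSlice ℂ k := rfl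
    obtain ⟨h2, h3⟩ := hF.raise_slice_mem g k
    simp only [h1, LinearMap.add_apply, LinearMap.smul_apply, Module.End.one_apply, h3, smul_zero,
      add_zero]
    exact F.add_mem (hF.slice_mem k) (F.smul_mem _ h2)
  · intro g m f hf
    have hf0 : ∀ i j, degA i + degB j ≠ m → f i j = 0 := by
      intro i j hij
      rw [← hf, degProj_apply, if_neg hij]
    have hA : ∀ i a, raiseA g i a ≠ 0 → degA i < degA a := by
      have h : ∀ g i a, decide (raiseA g i a = 0) || decide (degA i < degA a) := by
        decide
      intro i a h0
      simpa [h0] using h g i a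
    have hB : ∀ j b, raiseB g j b ≠ 0 → degB j < degB b := by
      have h : ∀ g j b, decide (raiseB g j b = 0) || decide (degB j < degB b) := by
        decide
      intro j b h0
      simpa [h0] using h g j b
    ext i j
    rw [gradeTrunc_degProj_apply]
    split_ifs with h
    · rfl
    · symm
      simp only [raiseAB, LinearMap.coe_mk, AddHom.coe_mk, Matrix.add_apply, Matrix.mul_apply,
        Matrix.map_apply, Matrix.transpose_apply]
      rw [Finset.sum_eq_zero, Finset.sum_eq_zero, add_zero]
      · intro b _
        by_cases h1 : raiseB g j b = 0
        · simp [h1]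
        · have := hB j b h1
          rw [hf0 i b (by omega), zero_mul]
      · intro a _
        by_cases h1 : raiseA g i a = 0
        · simp [h1]
        · have := hA i a h1
          rw [hf0 a j (by omega), mul_zero]

/-! ### Linearly independent elements of the images -/

section Certificate

theorem length_le_finrank_of_pairwise {ι V : Type*} [AddCommGroup V] [Module ℂ V]
    [FiniteDimensional ℂ V] (w : ι → V) (c : ι → V →ₗ[ℂ] ℂ) (L : List ι)
    (hL : L.Pairwise fun x y => c x (w y) = 0) (h0 : ∀ x ∈ L, c x (w x) ≠ 0) :
    ∀ K : Submodule ℂ V, (∀ x ∈ L, w x ∈ K) → L.length ≤ Module.finrank ℂ K := by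
  induction L with
  | nil => simp
  | cons x L ih =>
    intro K hK
    rw [List.pairwise_cons] at hL
    have h1 := ih hL.2 (fun y hy => h0 y (List.mem_cons_of_mem _ hy)) (K ⊓ LinearMap.ker (c x))
      fun y hy => ⟨hK y (List.mem_cons_of_mem _ hy), hL.1 y hy⟩
    have h2 : K ⊓ LinearMap.ker (c x) < K := by
      refine lt_of_le_of_ne inf_le_left fun h => h0 x List.mem_cons_self ?_
      have h3 : w x ∈ K ⊓ LinearMap.ker (c x) := by
        rw [h]
        exact hK x List.mem_cons_self
      exact h3.2
    have h4 := Submodule.finrank_lt_finrank_of_lt h2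
    simp only [List.length_cons]
    omega

/-- The coordinate at `(i, i', j)` of `wedge f e_a`. -/
def wedgeCoord (f : Matrix (Fin 6) (Fin 6) ℤ) (a i i' j : Fin 6) : ℤ :=
  (if i' = a then f i j else 0) - if i = a then f i' j else 0

theorem wedge_map_single (f : Matrix (Fin 6) (Fin 6) ℤ) (a i i' j : Fin 6) :
    wedge (f.map (Int.cast : ℤ → ℂ)) (Pi.single a 1) i i' j = (wedgeCoord f a i i' j : ℂ) := by
  simp [wedge, wedgeCoord, Pi.single_apply]

/-- A list of pairs `((k, a), (i, i', j))` exhibits linearly independent elements of the span of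
the tensors `wedge (M k) e_a` if the tensor at each place in the list has a nonzero coordinate at
`(i, i', j)`, where all the later tensors vanish. -/
def isTriangular {n : ℕ} (M : Fin n → Matrix (Fin 6) (Fin 6) ℤ) :
    List ((Fin n × Fin 6) × Fin 6 × Fin 6 × Fin 6) → Bool
  | [] => true
  | x :: L => !(wedgeCoord (M x.1.1) x.1.2 x.2.1 x.2.2.1 x.2.2.2 == 0) &&
      (L.all fun y => wedgeCoord (M y.1.1) y.1.2 x.2.1 x.2.2.1 x.2.2.2 == 0) && isTriangular M L

theorem length_le_finrank_wedgeSpan {n : ℕ} {M : Fin n → Matrix (Fin 6) (Fin 6) ℤ}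
    {F : Submodule ℂ (Matrix (Fin 6) (Fin 6) ℂ)}
    (hM : ∀ k, (M k).map (Int.cast : ℤ → ℂ) ∈ F)
    (L : List ((Fin n × Fin 6) × Fin 6 × Fin 6 × Fin 6)) (h : isTriangular M L = true) :
    L.length ≤ Module.finrank ℂ (wedgeSpan F) := by
  have key : (L.Pairwise fun x y => wedgeCoord (M y.1.1) y.1.2 x.2.1 x.2.2.1 x.2.2.2 = 0) ∧
      ∀ x ∈ L, wedgeCoord (M x.1.1) x.1.2 x.2.1 x.2.2.1 x.2.2.2 ≠ 0 := by
    induction L with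
    | nil => simp
    | cons x L ih =>
      simp only [isTriangular, Bool.and_eq_true, Bool.not_eq_true', beq_eq_false_iff_ne,
        List.all_eq_true, beq_iff_eq] at h
      obtain ⟨h1, h2⟩ := ih h.2
      exact ⟨List.pairwise_cons.2 ⟨h.1.2, h1⟩, List.forall_mem_cons.2 ⟨h.1.1, h2⟩⟩
  refine length_le_finrank_of_pairwise
    (fun x => wedge ((M x.1.1).map (Int.cast : ℤ → ℂ)) (Pi.single x.1.2 1))
    (fun x => LinearMap.proj (R := ℂ) (φ := fun _ : Fin 6 => ℂ) x.2.2.2 ∘ₗ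
      LinearMap.proj (R := ℂ) (φ := fun _ : Fin 6 => Fin 6 → ℂ) x.2.2.1 ∘ₗ
        LinearMap.proj (R := ℂ) (φ := fun _ : Fin 6 => Fin 6 → Fin 6 → ℂ) x.2.1)
    L ?_ ?_ _ fun x _ => ?_
  · refine key.1.imp fun {x y} hxy => ?_
    simp only [LinearMap.comp_apply, LinearMap.proj_apply, wedge_map_single, hxy, Int.cast_zero]
  · intro x hx
    simpa only [LinearMap.comp_apply, LinearMap.proj_apply, wedge_map_single, ne_eq,
      Int.cast_eq_zero] using key.2 x hx
  · exact Submodule.apply_mem_map₂ (wedgeₗ (Fin 6) (Fin 6)) (hM x.1.1) Submodule.mem_top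

/-- The slices of the structure tensor of the sextonions, followed by three further matrices. -/
def sliceExtension (x y z : Matrix (Fin 6) (Fin 6) ℤ) : Fin 9 → Matrix (Fin 6) (Fin 6) ℤ :=
  ![sextonionSlice ℤ 0, sextonionSlice ℤ 1, sextonionSlice ℤ 2, sextonionSlice ℤ 3,
    sextonionSlice ℤ 4, sextonionSlice ℤ 5, x, y, z]

/-- Each pair of digits `ij` in the name stands for the matrix with the entry `1` at `(i, j)`. -/
theorem exists_isTriangular_02_22_03 : ∃ L, isTriangular (sliceExtension (Matrix.single 0 2 1)
    (Matrix.single 2 2 1) (Matrix.single 0 3 1)) L = true ∧ L.length = 46 := by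
  refine ⟨
    [((0, 1), 0, 1, 0), ((0, 3), 0, 3, 0), ((0, 5), 0, 5, 0), ((1, 1), 0, 1, 1), ((1, 2), 1,
      2, 3), ((1, 3), 0, 3, 1), ((1, 4), 0, 4, 1), ((2, 1), 1, 2, 0), ((2, 3), 2, 3, 0), ((2,
      5), 2, 5, 0), ((3, 0), 0, 2, 1), ((3, 1), 1, 2, 1), ((3, 2), 2, 3, 3), ((3, 3), 2, 3,
      1), ((3, 4), 2, 4, 1), ((4, 0), 0, 3, 4), ((0, 4), 0, 4, 0), ((1, 5), 0, 5, 1), ((4, 1),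
      1, 3, 4), ((4, 2), 1, 2, 5), ((2, 4), 2, 4, 0), ((3, 5), 2, 5, 1), ((4, 3), 1, 3, 5),
      ((4, 4), 1, 4, 5), ((4, 5), 1, 5, 5), ((5, 0), 0, 2, 4), ((5, 1), 0, 1, 5), ((5, 2), 0,
      2, 5), ((5, 3), 0, 3, 5), ((5, 4), 0, 4, 5), ((5, 5), 0, 5, 5), ((6, 4), 0, 4, 2), ((6,
      5), 0, 5, 2), ((7, 4), 2, 4, 2), ((7, 5), 2, 5, 2), ((8, 2), 0, 2, 3), ((8, 3), 0, 3,
      3), ((8, 4), 0, 4, 3), ((8, 5), 0, 5, 3), ((0, 0), 0, 1, 2), ((2, 0), 0, 3, 2), ((0, 2),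
      0, 2, 0), ((7, 1), 1, 2, 2), ((8, 1), 0, 1, 3), ((7, 0), 0, 2, 2), ((2, 2), 2, 3, 2)], ?_, rfl⟩
  decide +kernel

theorem exists_isTriangular_transpose_02_22_00 : ∃ L, isTriangular (fun k =>
    (sliceExtension (Matrix.single 0 2 1) (Matrix.single 2 2 1) (Matrix.single 0 0 1) k).transpose)
      L = true ∧ L.length = 46 := by
  refine ⟨
    [((0, 0), 0, 2, 1), ((0, 1), 1, 2, 1), ((0, 4), 2, 4, 1), ((1, 0), 0, 3, 1), ((1, 1), 1,
      3, 1), ((1, 3), 1, 3, 0), ((1, 4), 1, 4, 0), ((2, 0), 0, 2, 3), ((2, 1), 1, 2, 3), ((2,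
      3), 0, 3, 2), ((2, 5), 0, 5, 2), ((3, 0), 0, 1, 2), ((3, 1), 1, 3, 3), ((3, 2), 2, 3,
      3), ((3, 3), 1, 3, 2), ((3, 5), 1, 5, 2), ((4, 0), 0, 1, 5), ((4, 1), 0, 1, 4), ((4, 2),
      1, 2, 5), ((0, 5), 2, 5, 1), ((2, 4), 2, 4, 3), ((4, 3), 0, 3, 4), ((1, 5), 3, 5, 1),
      ((3, 4), 3, 4, 3), ((4, 4), 0, 4, 4), ((4, 5), 0, 5, 4), ((5, 0), 0, 2, 4), ((5, 1), 1,
      2, 4), ((5, 2), 2, 3, 5), ((5, 3), 2, 3, 4), ((5, 4), 2, 4, 4), ((5, 5), 2, 5, 4), ((6,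
      3), 2, 3, 0), ((6, 4), 2, 4, 0), ((6, 5), 2, 5, 0), ((7, 1), 1, 2, 2), ((7, 3), 2, 3,
      2), ((7, 4), 2, 4, 2), ((7, 5), 2, 5, 2), ((8, 1), 0, 1, 0), ((8, 4), 0, 4, 0), ((8, 5),
      0, 5, 0), ((2, 2), 0, 2, 2), ((1, 2), 1, 2, 0), ((0, 3), 2, 3, 1), ((8, 3), 0, 3, 0)], ?_, rfl⟩
  decide +kernel

theorem exists_isTriangular_02_03_00 : ∃ L, isTriangular (sliceExtension (Matrix.single 0 2 1)
    (Matrix.single 0 3 1) (Matrix.single 0 0 1)) L = true ∧ L.length = 46 := by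
  refine ⟨
    [((0, 2), 1, 2, 2), ((0, 5), 1, 5, 2), ((1, 1), 0, 1, 1), ((1, 2), 1, 2, 3), ((1, 3), 0,
      3, 1), ((1, 4), 0, 4, 1), ((2, 1), 1, 2, 0), ((0, 3), 1, 3, 2), ((2, 2), 2, 3, 2), ((2,
      3), 2, 3, 0), ((2, 5), 2, 5, 0), ((3, 0), 0, 2, 1), ((3, 1), 1, 2, 1), ((3, 2), 2, 3,
      3), ((3, 3), 2, 3, 1), ((3, 4), 2, 4, 1), ((4, 0), 0, 3, 4), ((1, 5), 0, 5, 1), ((4, 1),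
      1, 3, 4), ((4, 2), 1, 2, 5), ((2, 4), 2, 4, 0), ((3, 5), 2, 5, 1), ((4, 3), 1, 3, 5),
      ((4, 4), 1, 4, 5), ((4, 5), 1, 5, 5), ((5, 0), 0, 2, 4), ((5, 1), 0, 1, 5), ((0, 4), 1,
      4, 2), ((5, 2), 0, 2, 5), ((5, 3), 0, 3, 5), ((5, 4), 0, 4, 5), ((5, 5), 0, 5, 5), ((6,
      2), 0, 2, 2), ((6, 4), 0, 4, 2), ((6, 5), 0, 5, 2), ((7, 2), 0, 2, 3), ((7, 3), 0, 3,
      3), ((7, 4), 0, 4, 3), ((7, 5), 0, 5, 3), ((8, 3), 0, 3, 0), ((8, 4), 0, 4, 0), ((8, 5),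
      0, 5, 0), ((2, 0), 0, 3, 2), ((8, 2), 0, 2, 0), ((1, 0), 0, 1, 3), ((6, 1), 0, 1, 2)], ?_, rfl⟩
  decide +kernel

theorem exists_isTriangular_02_00_10 : ∃ L, isTriangular (sliceExtension (Matrix.single 0 2 1)
    (Matrix.single 0 0 1) (Matrix.single 1 0 1)) L = true ∧ L.length = 46 := by
  refine ⟨
    [((0, 2), 1, 2, 2), ((0, 5), 1, 5, 2), ((1, 0), 0, 1, 3), ((1, 1), 0, 1, 1), ((1, 2), 1,
      2, 3), ((1, 3), 0, 3, 1), ((1, 4), 0, 4, 1), ((2, 2), 2, 3, 2), ((2, 3), 2, 3, 0), ((2,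
      5), 2, 5, 0), ((3, 0), 0, 2, 1), ((3, 1), 1, 2, 1), ((3, 2), 2, 3, 3), ((3, 3), 2, 3,
      1), ((3, 4), 2, 4, 1), ((4, 0), 0, 3, 4), ((1, 5), 0, 5, 1), ((4, 1), 1, 3, 4), ((4, 2),
      1, 2, 5), ((2, 4), 2, 4, 0), ((3, 5), 2, 5, 1), ((4, 3), 1, 3, 5), ((4, 4), 1, 4, 5),
      ((4, 5), 1, 5, 5), ((5, 0), 0, 2, 4), ((5, 1), 0, 1, 5), ((0, 4), 1, 4, 2), ((5, 2), 0,
      2, 5), ((5, 3), 0, 3, 5), ((5, 4), 0, 4, 5), ((5, 5), 0, 5, 5), ((6, 2), 0, 2, 2), ((6,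
      4), 0, 4, 2), ((6, 5), 0, 5, 2), ((7, 4), 0, 4, 0), ((7, 5), 0, 5, 0), ((8, 3), 1, 3,
      0), ((8, 4), 1, 4, 0), ((8, 5), 1, 5, 0), ((0, 0), 0, 1, 2), ((2, 0), 0, 3, 2), ((7, 2),
      0, 2, 0), ((0, 3), 0, 3, 0), ((2, 1), 1, 3, 2), ((8, 2), 1, 2, 0), ((8, 0), 0, 1, 0)], ?_, rfl⟩
  decide +kernel

end Certificate

/-! ### Borel-fixed subspaces for nine summands -/

theorem finrank_le_eight {F : Submodule ℂ (Matrix (Fin 6) (Fin 6) ℂ)}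
    (X Y : Matrix (Fin 6) (Fin 6) ℂ)
    (h : ∀ f ∈ F, ∃ (z : Fin 6 → ℂ) (x y : ℂ), f = sextonionMatrix z + x • X + y • Y) :
    Module.finrank ℂ F ≤ 8 := by
  have hle : F ≤ Submodule.span ℂ (Set.range (sextonionSlice ℂ)) ⊔
      (Submodule.span ℂ {X} ⊔ Submodule.span ℂ {Y}) := by
    intro f hf
    obtain ⟨z, x, y, rfl⟩ := h f hf
    rw [sextonionMatrix_eq_sum, add_assoc]
    refine Submodule.add_mem_sup (Submodule.sum_mem _ fun k _ => Submodule.smul_mem _ _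
      (Submodule.subset_span ⟨k, rfl⟩)) (Submodule.add_mem_sup ?_ ?_) <;>
    exact Submodule.smul_mem _ _ (Submodule.mem_span_singleton_self _)
  refine (Submodule.finrank_mono hle).trans
    ((Submodule.finrank_add_le_finrank_add_finrank _ _).trans ?_)
  have h1 : Module.finrank ℂ (Submodule.span ℂ (Set.range (sextonionSlice ℂ))) ≤ 6 :=
    (finrank_range_le_card (R := ℂ) (sextonionSlice ℂ)).trans (by simp)
  have h2 := Submodule.finrank_add_le_finrank_add_finrank (Submodule.span ℂ {X})
    (Submodule.span ℂ {Y})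
  have h3 : ∀ Z : Matrix (Fin 6) (Fin 6) ℂ, Module.finrank ℂ (Submodule.span ℂ {Z}) ≤ 1 := by
    intro Z
    simpa using finrank_span_le_card (R := ℂ) ({Z} : Set (Matrix (Fin 6) (Fin 6) ℂ))
  have h4 := h3 X
  have h5 := h3 Y
  omega

/-- A subspace of `A ⊗ B` as `IsApolar` yields it from border rank at most `9`, which is moreover
fixed by the torus and the unipotent symmetries of the tensor. -/
structure IsBorelFixed (F : Submodule ℂ (Matrix (Fin 6) (Fin 6) ℂ)) : Prop where
  isApolar : IsApolar sextonionTensor 9 F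
  degProj_mem : ∀ f ∈ F, ∀ h, degProj h f ∈ F
  raiseAB_mem : ∀ k, ∀ f ∈ F, raiseAB k f ∈ F

theorem raiseAB_zero_apply (f : Matrix (Fin 6) (Fin 6) ℂ) : raiseAB 0 f =
    Matrix.of ![fun j => f 2 j, fun j => f 3 j, 0, 0, 0, 0] +
      Matrix.of fun i => ![0, 0, 0, 0, f i 5, 0] := by
  ext i j
  simp only [raiseAB, LinearMap.coe_mk, AddHom.coe_mk, Matrix.add_apply, Matrix.mul_apply,
    Fin.sum_univ_six, Matrix.map_apply, Matrix.transpose_apply]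
  fin_cases i <;> fin_cases j <;> simp [raiseA, raiseB]

theorem raiseAB_one_apply (f : Matrix (Fin 6) (Fin 6) ℂ) : raiseAB 1 f =
    Matrix.of ![0, 0, 0, 0, 0, fun j => -f 4 j] +
      Matrix.of fun i => ![f i 1, 0, f i 3, 0, 0, 0] := by
  ext i j
  simp only [raiseAB, LinearMap.coe_mk, AddHom.coe_mk, Matrix.add_apply, Matrix.mul_apply,
    Fin.sum_univ_six, Matrix.map_apply, Matrix.transpose_apply]
  fin_cases i <;> fin_cases j <;> simp [raiseA, raiseB]

theorem raiseAB_two_apply (f : Matrix (Fin 6) (Fin 6) ℂ) : raiseAB 2 f =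
    Matrix.of ![fun j => f 1 j, 0, fun j => f 3 j, 0, 0, 0] +
      Matrix.of fun i => ![0, 0, -f i 0, -f i 1, 0, 0] := by
  ext i j
  simp only [raiseAB, LinearMap.coe_mk, AddHom.coe_mk, Matrix.add_apply, Matrix.mul_apply,
    Fin.sum_univ_six, Matrix.map_apply, Matrix.transpose_apply]
  fin_cases i <;> fin_cases j <;> simp [raiseA, raiseB]

theorem raiseAB_three_apply (f : Matrix (Fin 6) (Fin 6) ℂ) : raiseAB 3 f =
    Matrix.of ![0, 0, 0, fun j => f 5 j, 0, 0] +
      Matrix.of fun i => ![0, -f i 4, 0, 0, 0, 0] := by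
  ext i j
  simp only [raiseAB, LinearMap.coe_mk, AddHom.coe_mk, Matrix.add_apply, Matrix.mul_apply,
    Fin.sum_univ_six, Matrix.map_apply, Matrix.transpose_apply]
  fin_cases i <;> fin_cases j <;> simp [raiseA, raiseB]

namespace IsBorelFixed

variable {F : Submodule ℂ (Matrix (Fin 6) (Fin 6) ℂ)}

/-- New integral elements of a Borel-fixed subspace are found by applying a symmetry, adding a
combination of slices and dividing by an integer. -/
theorem mem_of_raise (hF : IsBorelFixed F) (k : Fin 4) (z : Fin 6 → ℤ)
    {x y : Matrix (Fin 6) (Fin 6) ℤ} (hy : y.map (Int.cast : ℤ → ℂ) ∈ F) {c : ℤ} (hc : c ≠ 0)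
    (h : c • x = raiseInt k y + sextonionMatrix z) : x.map (Int.cast : ℤ → ℂ) ∈ F := by
  have h1 : (c : ℂ) • x.map (Int.cast : ℤ → ℂ) =
      raiseAB k (y.map (Int.cast : ℤ → ℂ)) + sextonionMatrix fun l => (z l : ℂ) := by
    have h2 : sextonionMatrix (fun l => (z l : ℂ)) =
        (sextonionMatrix z).map (Int.cast : ℤ → ℂ) := by
      ext i j
      fin_cases i <;> fin_cases j <;> simp [sextonionMatrix]
    rw [raiseAB_map, h2]
    ext i j
    have h3 := congrArg (Int.cast : ℤ → ℂ) (congrFun (congrFun h i) j)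
    simpa using h3
  have h4 : (c : ℂ) ≠ 0 := by exact_mod_cast hc
  rw [← F.smul_mem_iff h4, h1]
  exact F.add_mem (hF.raiseAB_mem k _ hy) (hF.isApolar.sextonionMatrix_mem _)

theorem sliceExtension_mem (hF : IsBorelFixed F) {x y z : Matrix (Fin 6) (Fin 6) ℤ}
    (hx : x.map (Int.cast : ℤ → ℂ) ∈ F) (hy : y.map (Int.cast : ℤ → ℂ) ∈ F)
    (hz : z.map (Int.cast : ℤ → ℂ) ∈ F) (k : Fin 9) :
    (sliceExtension x y z k).map (Int.cast : ℤ → ℂ) ∈ F := by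
  have h : ∀ l, (sextonionSlice ℤ l).map (Int.cast : ℤ → ℂ) ∈ F := by
    intro l
    rw [← sextonionSlice_map]
    exact hF.isApolar.sextonionMatrix_mem _
  fin_cases k
  exacts [h 0, h 1, h 2, h 3, h 4, h 5, hx, hy, hz]

/-- The image of `F ⊗ A` in `Λ²A ⊗ B` has dimension at most `9 * 5 = 45`. -/
theorem false_of_isTriangular (hF : IsBorelFixed F) {x y z : Matrix (Fin 6) (Fin 6) ℤ}
    (hx : x.map (Int.cast : ℤ → ℂ) ∈ F) (hy : y.map (Int.cast : ℤ → ℂ) ∈ F)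
    (hz : z.map (Int.cast : ℤ → ℂ) ∈ F)
    (h : ∃ L, isTriangular (sliceExtension x y z) L = true ∧ L.length = 46) : False := by
  obtain ⟨L, hL, hlen⟩ := h
  have h1 := length_le_finrank_wedgeSpan (hF.sliceExtension_mem hx hy hz) L hL
  have h2 := hF.isApolar.finrank_left
  simp only [Fintype.card_fin] at h2
  omega

theorem false_of_isTriangular_transpose (hF : IsBorelFixed F) {x y z : Matrix (Fin 6) (Fin 6) ℤ}
    (hx : x.map (Int.cast : ℤ → ℂ) ∈ F) (hy : y.map (Int.cast : ℤ → ℂ) ∈ F)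
    (hz : z.map (Int.cast : ℤ → ℂ) ∈ F)
    (h : ∃ L, isTriangular (fun k => (sliceExtension x y z k).transpose) L = true ∧
      L.length = 46) : False := by
  obtain ⟨L, hL, hlen⟩ := h
  have h1 := length_le_finrank_wedgeSpan
    (fun k => mem_transposeSubmodule (hF.sliceExtension_mem hx hy hz k)) L hL
  have h2 := hF.isApolar.finrank_right
  simp only [Fintype.card_fin] at h2
  omega

/-! ### Candidate weight vectors -/

theorem single_02_of_00 (hF : IsBorelFixed F)
    (h : (Matrix.single 0 0 (1 : ℤ)).map (Int.cast : ℤ → ℂ) ∈ F) :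
    (Matrix.single 0 2 (1 : ℤ)).map (Int.cast : ℤ → ℂ) ∈ F :=
  hF.mem_of_raise 2 0 h (c := -1) (by decide) (by decide +kernel)

theorem single_02_of_22 (hF : IsBorelFixed F)
    (h : (Matrix.single 2 2 (1 : ℤ)).map (Int.cast : ℤ → ℂ) ∈ F) :
    (Matrix.single 0 2 (1 : ℤ)).map (Int.cast : ℤ → ℂ) ∈ F :=
  hF.mem_of_raise 0 0 h one_ne_zero (by decide +kernel)

theorem not_00_and_03 (hF : IsBorelFixed F)
    (h : (Matrix.single 0 0 (1 : ℤ)).map (Int.cast : ℤ → ℂ) ∈ F)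
    (h' : (Matrix.single 0 3 (1 : ℤ)).map (Int.cast : ℤ → ℂ) ∈ F) : False :=
  hF.false_of_isTriangular (hF.single_02_of_00 h) h' h exists_isTriangular_02_03_00

theorem not_00_and_22 (hF : IsBorelFixed F)
    (h : (Matrix.single 0 0 (1 : ℤ)).map (Int.cast : ℤ → ℂ) ∈ F)
    (h' : (Matrix.single 2 2 (1 : ℤ)).map (Int.cast : ℤ → ℂ) ∈ F) : False :=
  hF.false_of_isTriangular_transpose (hF.single_02_of_00 h) h' h
    exists_isTriangular_transpose_02_22_00

theorem not_22_and_03 (hF : IsBorelFixed F)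
    (h : (Matrix.single 2 2 (1 : ℤ)).map (Int.cast : ℤ → ℂ) ∈ F)
    (h' : (Matrix.single 0 3 (1 : ℤ)).map (Int.cast : ℤ → ℂ) ∈ F) : False :=
  hF.false_of_isTriangular (hF.single_02_of_22 h) h h' exists_isTriangular_02_22_03

theorem single_01_notMem (hF : IsBorelFixed F) :
    (Matrix.single 0 1 (1 : ℤ)).map (Int.cast : ℤ → ℂ) ∉ F := fun h =>
  hF.not_00_and_03 (hF.mem_of_raise 1 0 h one_ne_zero (by decide +kernel))
    (hF.mem_of_raise 2 0 h (c := -1) (by decide) (by decide +kernel))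

theorem single_20_notMem (hF : IsBorelFixed F) :
    (Matrix.single 2 0 (1 : ℤ)).map (Int.cast : ℤ → ℂ) ∉ F := fun h =>
  hF.not_00_and_22 (hF.mem_of_raise 0 0 h one_ne_zero (by decide +kernel))
    (hF.mem_of_raise 2 0 h (c := -1) (by decide) (by decide +kernel))

theorem single_23_notMem (hF : IsBorelFixed F) :
    (Matrix.single 2 3 (1 : ℤ)).map (Int.cast : ℤ → ℂ) ∉ F := fun h =>
  hF.not_22_and_03 (hF.mem_of_raise 1 0 h one_ne_zero (by decide +kernel))
    (hF.mem_of_raise 0 0 h one_ne_zero (by decide +kernel))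

theorem single_10_notMem (hF : IsBorelFixed F) :
    (Matrix.single 1 0 (1 : ℤ)).map (Int.cast : ℤ → ℂ) ∉ F := fun h => by
  have h1 : (Matrix.single 0 0 (1 : ℤ)).map (Int.cast : ℤ → ℂ) ∈ F :=
    hF.mem_of_raise 2 ![1, 0, 0, 0, 0, 0] h (c := 2) (by decide) (by decide +kernel)
  exact hF.false_of_isTriangular (hF.single_02_of_00 h1) h1 h exists_isTriangular_02_00_10

theorem single_mem_of_apply_ne_zero (hF : IsBorelFixed F) {g : Matrix (Fin 6) (Fin 6) ℂ}
    (hg : g ∈ F) {i j : Fin 6} (hne : g i j ≠ 0)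
    (h : ∀ i' j', degA i' + degB j' = degA i + degB j → (i = i' ∧ j = j') ∨ g i' j' = 0) :
    (Matrix.single i j (1 : ℤ)).map (Int.cast : ℤ → ℂ) ∈ F := by
  have h1 : degProj (degA i + degB j) g =
      g i j • (Matrix.single i j (1 : ℤ)).map (Int.cast : ℤ → ℂ) := by
    ext i' j'
    by_cases h2 : i = i' ∧ j = j'
    · obtain ⟨rfl, rfl⟩ := h2
      simp [degProj_apply]
    · rw [degProj_apply, Matrix.smul_apply, Matrix.map_apply, Matrix.single_apply, if_neg h2]
      split_ifs with h3
      · simpa using (h i' j' h3).resolve_left h2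
      · simp
  rw [← F.smul_mem_iff hne, ← h1]
  exact hF.degProj_mem g hg _

/-- If the total degree of the position `(i, j)` is shared only by `(i₁, j₁)`, and the same slice has
the entry `1` at both positions, then subtracting a multiple of this slice from `g` isolates the
position `(i, j)`. -/
theorem single_mem_of_slice (hF : IsBorelFixed F) {g : Matrix (Fin 6) (Fin 6) ℂ} (hg : g ∈ F)
    {i j i₁ j₁ : Fin 6} (k : Fin 6) (hk : sextonionSlice ℤ k i j = 1)
    (hk₁ : sextonionSlice ℤ k i₁ j₁ = 1) (hne : g i j ≠ g i₁ j₁)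
    (h : ∀ i' j', degA i' + degB j' = degA i + degB j → (i = i' ∧ j = j') ∨ i' = i₁ ∧ j' = j₁) :
    (Matrix.single i j (1 : ℤ)).map (Int.cast : ℤ → ℂ) ∈ F := by
  have hs : ∀ i' j', (g - g i₁ j₁ • sextonionSlice ℂ k) i' j' =
      g i' j' - g i₁ j₁ * (sextonionSlice ℤ k i' j' : ℂ) := by
    intro i' j'
    rw [Matrix.sub_apply, Matrix.smul_apply, sextonionSlice_cast, smul_eq_mul]
  refine hF.single_mem_of_apply_ne_zero (g := g - g i₁ j₁ • sextonionSlice ℂ k)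
    (F.sub_mem hg (F.smul_mem _ (hF.isApolar.sextonionMatrix_mem _))) ?_ fun i' j' hd => ?_
  · rw [hs, hk]
    simpa [sub_eq_zero] using hne
  · refine (h i' j' hd).imp_right ?_
    rintro ⟨rfl, rfl⟩
    rw [hs, hk₁]
    simp

theorem apply_10 (hF : IsBorelFixed F) {f : Matrix (Fin 6) (Fin 6) ℂ} (hf : f ∈ F) :
    f 1 0 = 0 := by
  by_contra hne
  refine hF.single_10_notMem (hF.single_mem_of_apply_ne_zero hf hne fun i j h => Or.inl ?_)
  revert i j
  decide

theorem apply_23 (hF : IsBorelFixed F) {f : Matrix (Fin 6) (Fin 6) ℂ} (hf : f ∈ F) :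
    f 2 3 = 0 := by
  by_contra hne
  refine hF.single_23_notMem (hF.single_mem_of_apply_ne_zero hf hne fun i j h => Or.inl ?_)
  revert i j
  decide

theorem apply_01 (hF : IsBorelFixed F) {f : Matrix (Fin 6) (Fin 6) ℂ} (hf : f ∈ F) :
    f 0 1 = f 1 3 := by
  by_contra hne
  refine hF.single_01_notMem (hF.single_mem_of_slice hf 1 (by decide) (by decide) hne ?_)
  decide

theorem apply_20 (hF : IsBorelFixed F) {f : Matrix (Fin 6) (Fin 6) ℂ} (hf : f ∈ F) :
    f 2 0 = f 3 2 := by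
  by_contra hne
  refine hF.single_20_notMem (hF.single_mem_of_slice hf 2 (by decide) (by decide) hne ?_)
  decide

theorem single_00_mem (hF : IsBorelFixed F) {f : Matrix (Fin 6) (Fin 6) ℂ} (hf : f ∈ F)
    (hne : f 0 0 ≠ f 1 2) : (Matrix.single 0 0 (1 : ℤ)).map (Int.cast : ℤ → ℂ) ∈ F := by
  refine hF.single_mem_of_slice hf 0 (by decide) (by decide) hne ?_
  decide

theorem single_03_mem (hF : IsBorelFixed F) {f : Matrix (Fin 6) (Fin 6) ℂ} (hf : f ∈ F)
    (hne : f 0 3 ≠ 0) : (Matrix.single 0 3 (1 : ℤ)).map (Int.cast : ℤ → ℂ) ∈ F := by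
  refine hF.single_mem_of_apply_ne_zero hf hne fun i j h => Or.inl ?_
  revert i j
  decide

theorem single_22_mem (hF : IsBorelFixed F) {f : Matrix (Fin 6) (Fin 6) ℂ} (hf : f ∈ F)
    (hne : f 2 2 ≠ 0) : (Matrix.single 2 2 (1 : ℤ)).map (Int.cast : ℤ → ℂ) ∈ F := by
  refine hF.single_mem_of_apply_ne_zero hf hne fun i j h => Or.inl ?_
  revert i j
  decide

/-! ### The elements of a Borel-fixed subspace -/

/-- Relations between the entries of all elements of a Borel-fixed subspace yield further ones when
they are applied to the images under the infinitesimal symmetries. -/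
theorem apply_lower_left (hF : IsBorelFixed F) :
    ∀ f ∈ F, f 2 1 = f 3 3 ∧ f 1 1 = 0 ∧ f 3 0 = 0 ∧ f 3 1 = 0 := by
  have h21 : ∀ f ∈ F, f 2 1 = f 3 3 := fun f hf => by
    simpa [raiseAB_one_apply] using hF.apply_20 (hF.raiseAB_mem 1 f hf)
  have h11 : ∀ f ∈ F, f 1 1 = 0 := fun f hf => by
    simpa [raiseAB_one_apply] using hF.apply_10 (hF.raiseAB_mem 1 f hf)
  have h30 : ∀ f ∈ F, f 3 0 = 0 := fun f hf => by
    simpa [raiseAB_zero_apply] using hF.apply_10 (hF.raiseAB_mem 0 f hf)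
  have h31 : ∀ f ∈ F, f 3 1 = 0 := fun f hf => by
    simpa [raiseAB_one_apply] using h30 _ (hF.raiseAB_mem 1 f hf)
  exact fun f hf => ⟨h21 f hf, h11 f hf, h30 f hf, h31 f hf⟩

theorem apply_border (hF : IsBorelFixed F) :
    ∀ f ∈ F, (f 0 4 = 0 ∧ f 1 4 = 0 ∧ f 2 5 = 0 ∧ f 3 5 = 0 ∧ f 5 2 = 0 ∧ f 5 0 = 0 ∧ f 4 3 = 0 ∧
      f 4 1 = 0) ∧ (f 2 4 = -f 0 5 ∧ f 5 3 = f 0 5 ∧ f 4 2 = f 0 5) ∧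
      f 1 5 = -f 3 4 ∧ f 5 1 = f 3 4 ∧ f 4 0 = f 3 4 := by
  have h04 : ∀ f ∈ F, f 0 4 = 0 := fun f hf => by
    simpa [raiseAB_three_apply] using hF.apply_01 (hF.raiseAB_mem 3 f hf)
  have h14 : ∀ f ∈ F, f 1 4 = 0 := fun f hf => by
    simpa [raiseAB_two_apply] using h04 _ (hF.raiseAB_mem 2 f hf)
  have h24 : ∀ f ∈ F, f 2 4 = -f 0 5 := fun f hf => by
    have h := h04 _ (hF.raiseAB_mem 0 f hf)
    simp [raiseAB_zero_apply] at h
    linear_combination h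
  have h25 : ∀ f ∈ F, f 2 5 = 0 := fun f hf => by
    have h := h24 _ (hF.raiseAB_mem 0 f hf)
    simp [raiseAB_zero_apply] at h
    linear_combination h / 2
  have h35 : ∀ f ∈ F, f 3 5 = 0 := fun f hf => by
    simpa [raiseAB_two_apply] using h25 _ (hF.raiseAB_mem 2 f hf)
  have h52 : ∀ f ∈ F, f 5 2 = 0 := fun f hf => by
    simpa [raiseAB_three_apply, eq_comm] using hF.apply_20 (hF.raiseAB_mem 3 f hf)
  have h50 : ∀ f ∈ F, f 5 0 = 0 := fun f hf => by
    simpa [raiseAB_two_apply] using h52 _ (hF.raiseAB_mem 2 f hf)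
  have h53 : ∀ f ∈ F, f 5 3 = f 0 5 := fun f hf => by
    have h := (hF.apply_lower_left _ (hF.raiseAB_mem 3 f hf)).1
    simp [raiseAB_three_apply] at h
    linear_combination -h - h24 f hf
  have h42 : ∀ f ∈ F, f 4 2 = f 0 5 := fun f hf => by
    have h := h52 _ (hF.raiseAB_mem 1 f hf)
    simp [raiseAB_one_apply] at h
    linear_combination -h + h53 f hf
  have h43 : ∀ f ∈ F, f 4 3 = 0 := fun f hf => by
    simpa [raiseAB_one_apply] using h42 _ (hF.raiseAB_mem 1 f hf)
  have h41 : ∀ f ∈ F, f 4 1 = 0 := fun f hf => by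
    simpa [raiseAB_two_apply] using h43 _ (hF.raiseAB_mem 2 f hf)
  refine fun f hf => ⟨⟨h04 f hf, h14 f hf, h25 f hf, h35 f hf, h52 f hf, h50 f hf, h43 f hf,
    h41 f hf⟩, ⟨h24 f hf, h53 f hf, h42 f hf⟩, ?_⟩
  have h1 := h24 _ (hF.raiseAB_mem 2 f hf)
  have h2 := h53 _ (hF.raiseAB_mem 2 f hf)
  have h3 := h42 _ (hF.raiseAB_mem 2 f hf)
  simp [raiseAB_two_apply] at h1 h2 h3
  exact ⟨by linear_combination h1, by linear_combination -h1 - h2, by linear_combination -h1 - h3⟩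

theorem apply_corner (hF : IsBorelFixed F) :
    ∀ f ∈ F, f 4 4 = 0 ∧ f 4 5 = 0 ∧ f 5 4 = 0 ∧ f 5 5 = 0 := by
  have h54 : ∀ f ∈ F, f 5 4 = 0 := fun f hf => by
    simpa [raiseAB_three_apply, eq_comm] using
      (hF.apply_border _ (hF.raiseAB_mem 3 f hf)).2.2.1
  have h55 : ∀ f ∈ F, f 5 5 = 0 := fun f hf => by
    simpa [raiseAB_zero_apply] using h54 _ (hF.raiseAB_mem 0 f hf)
  have h44 : ∀ f ∈ F, f 4 4 = 0 := fun f hf => by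
    simpa [raiseAB_one_apply] using h54 _ (hF.raiseAB_mem 1 f hf)
  have h45 : ∀ f ∈ F, f 4 5 = 0 := fun f hf => by
    simpa [raiseAB_one_apply] using h55 _ (hF.raiseAB_mem 1 f hf)
  exact fun f hf => ⟨h44 f hf, h45 f hf, h54 f hf, h55 f hf⟩

/-- The elements of a Borel-fixed subspace are combinations of slices and of four more matrices. -/
theorem eq_sextonionMatrix_add (hF : IsBorelFixed F) {f : Matrix (Fin 6) (Fin 6) ℂ} (hf : f ∈ F) :
    f = sextonionMatrix ![f 1 2, f 0 1, f 2 0, f 2 1, f 3 4, f 0 5] +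
      f 0 2 • Matrix.single 0 2 1 +
      ((f 0 0 - f 1 2) • Matrix.single 0 0 1 + f 0 3 • Matrix.single 0 3 1 +
        f 2 2 • Matrix.single 2 2 1) := by
  have h01 := hF.apply_01 hf
  have h10 := hF.apply_10 hf
  have h20 := hF.apply_20 hf
  have h23 := hF.apply_23 hf
  obtain ⟨h21, h11, h30, h31⟩ := hF.apply_lower_left f hf
  obtain ⟨⟨h04, h14, h25, h35, h52, h50, h43, h41⟩, ⟨h24, h53, h42⟩, h15, h51, h40⟩ :=
    hF.apply_border f hf
  obtain ⟨h44, h45, h54, h55⟩ := hF.apply_corner f hf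
  ext i j
  fin_cases i <;> fin_cases j <;> simp [sextonionMatrix, *]

/-- Of the matrices with a single nonzero entry at `(0, 0)`, `(0, 3)` or `(2, 2)`, at most one lies in
a Borel-fixed subspace. Together with the six slices and the position `(0, 2)` this gives dimension
at most eight instead of nine. -/
theorem false (hF : IsBorelFixed F) : False := by
  have h9 := hF.isApolar.finrank_eq
  have key : ∀ Y : Matrix (Fin 6) (Fin 6) ℂ, (∀ f ∈ F, ∃ y : ℂ,
      (f 0 0 - f 1 2) • Matrix.single 0 0 1 + f 0 3 • Matrix.single 0 3 1 +
        f 2 2 • Matrix.single 2 2 1 = y • Y) → False := by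
    intro Y hY
    have h8 := finrank_le_eight (F := F) (Matrix.single 0 2 1) Y fun f hf => by
      obtain ⟨y, hy⟩ := hY f hf
      exact ⟨_, _, y, (hF.eq_sextonionMatrix_add hf).trans (by rw [hy])⟩
    omega
  by_cases h00 : (Matrix.single 0 0 (1 : ℤ)).map (Int.cast : ℤ → ℂ) ∈ F
  · refine key (Matrix.single 0 0 1) fun f hf => ⟨f 0 0 - f 1 2, ?_⟩
    have h1 : f 0 3 = 0 := by
      by_contra hne
      exact hF.not_00_and_03 h00 (hF.single_03_mem hf hne)
    have h2 : f 2 2 = 0 := by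
      by_contra hne
      exact hF.not_00_and_22 h00 (hF.single_22_mem hf hne)
    rw [h1, h2, zero_smul, zero_smul, add_zero, add_zero]
  have h1 : ∀ f ∈ F, f 0 0 - f 1 2 = 0 := by
    intro f hf
    by_contra hne
    exact h00 (hF.single_00_mem hf (sub_ne_zero.1 hne))
  by_cases h22 : (Matrix.single 2 2 (1 : ℤ)).map (Int.cast : ℤ → ℂ) ∈ F
  · refine key (Matrix.single 2 2 1) fun f hf => ⟨f 2 2, ?_⟩
    have h2 : f 0 3 = 0 := by
      by_contra hne
      exact hF.not_22_and_03 h22 (hF.single_03_mem hf hne)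
    rw [h1 f hf, h2, zero_smul, zero_smul, zero_add, zero_add]
  · refine key (Matrix.single 0 3 1) fun f hf => ⟨f 0 3, ?_⟩
    have h2 : f 2 2 = 0 := by
      by_contra hne
      exact h22 (hF.single_22_mem hf hne)
    rw [h1 f hf, h2, zero_smul, zero_smul, zero_add, add_zero]

end IsBorelFixed

/-! ### The border rank -/

theorem borderRank_sextonionTensor : borderRank sextonionTensor = 10 := by
  refine le_antisymm borderRank_sextonionTensor_le ?_
  by_contra hlt
  obtain ⟨F₀, hF₀⟩ := exists_isApolar (T := sextonionTensor) (r := 9) (by omega) (by simp)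
  obtain ⟨F, hF, hdeg, hraise⟩ := exists_isApolar_stable hF₀
  exact IsBorelFixed.false ⟨hF, hdeg, hraise⟩

theorem mainTheorem9 :
    (∀ b : Module.Basis (Fin 6) ℂ Sextonion, borderRank (structureTensor sextonionMul b) = 10) ∧
      borderRank caseIIITensor = 10 :=
  ⟨fun b => (borderRank_structureTensor_sextonionMul b).trans borderRank_sextonionTensor,
    borderRank_sextonionTensor_eq_caseIIITensor.trans borderRank_sextonionTensor⟩
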